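/- **Setting.** Let $\mathcal X=\mathcal X_1\times\dots\times\mathcal X_d$ be a product of measurable spaces with $d\ge 1$. For $x\in\mathcal X$ write $x_{-i}$ for $x$ with its $i$-th coordinate removed. Let $\pi$ be a probability measure on $\mathcal X$. Fix a version of its full conditional distributions $\pi(\cdot\mid x_{-i})$, defined for every $x_{-i}$, with finite densities $\pi(y\mid x_{-i})$ with respect to $\sigma$-finite reference measures $\lambda_i$ on $\mathcal X_i$. Let $\|\mu-\nu\|_{TV}=\sup_A|\mu(A)-\nu(A)|$. A Markov kernel $P$ is *uniformly ergodic* with limit $\pi$ if there are $M<\infty$ and $0\le\rho<1$ with $\|P^n(x,\cdot)-\pi\|_{TV}\le M\rho^n$ for all $x$ and $n$. For some $0<\varepsilon\le 1/d$ let $\mathcal Y=[\varepsilon,1]^d\cap\Delta_{d-1}$, where $\Delta_{d-1}$ is the probability simplex. For $\beta\in\mathcal Y$, the random scan Gibbs sampler $\mathrm{RSG}(\beta)$ chooses a coordinate $i$ with probability $\beta_i$ and replaces $x_i$ by a draw from $\pi(\cdot\mid x_{-i})$. For each $i$ let $\{Q_{x_{-i},\gamma_i}(x_i,\cdot)\}_{\gamma_i\in\Gamma_i}$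 be proposal distributions on $\mathcal X_i$ with finite densities $q_{x_{-i},\gamma_i}(x_i,\cdot)$ with respect to $\lambda_i$, jointly measurable in all arguments. Let $P_{x_{-i},\gamma_i}$ be the resulting Metropolis–Hastings kernel on $\mathcal X_i$ with target $\pi(\cdot\mid x_{-i})$: a proposal $y$ is accepted with probability $$\min\Big(1,\frac{\pi(y\mid x_{-i})\,q_{x_{-i},\gamma_i}(y,x_i)}{\pi(x_i\mid x_{-i})\,q_{x_{-i},\gamma_i}(x_i,y)}\Big),$$ which is read as $1$ if the denominator vanishes. Put $\Gamma=\Gamma_1\times\dots\times\Gamma_d$. The doubly adaptive sampler **AdapRSadapMwG** started at $(x_0,\alpha_0,\gamma_0)\in\mathcal X\times\mathcal Y\times\Gamma$ is the process $(X_n,\alpha_n,\gamma_n)_{n\ge0}$ defined as follows. At each step $n\ge 1$, $(\alpha_n,\gamma_n)\in\mathcal Y\times\Gamma$ is produced from the history $(X_k,\alpha_k,\gamma_k)_{k<n}$ by an arbitrary measurable, possibly randomised, update rule. Then a coordinate $i$ is chosen with probability $\alpha_{n,i}$, and $X_n$ is obtained from $X_{n-1}$ by replacing $X_{n-1,i}$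 by a draw from $P_{X_{n-1,-i},\gamma_{n,i}}(X_{n-1,i},\cdot)$. Write $\mathbb P_{x_0,\alpha_0,\gamma_0}$ for its law and $T(x_0,\alpha_0,\gamma_0,n)=\|\mathbb P_{x_0,\alpha_0,\gamma_0}(X_n\in\cdot)-\pi\|_{TV}$. For $n\ge 0$ put $$A_n=|\alpha_{n+1}-\alpha_n|,\qquad D_{n,i}=\sup_{x\in\mathcal X}\|P_{x_{-i},\gamma_{n+1,i}}(x_i,\cdot)-P_{x_{-i},\gamma_{n,i}}(x_i,\cdot)\|_{TV}.$$ **Theorem.** Assume that * (b) there is $\beta\in\mathcal Y$ such that $\mathrm{RSG}(\beta)$ is uniformly ergodic with limit $\pi$; * (c) for every $i$, every kernel $P_{x_{-i},\gamma_i}$ is uniformly ergodic with limit $\pi(\cdot\mid x_{-i})$, and there are $s_i>0$ and an integer $m_i\ge 0$ such that for all $x_{-i}$ and $\gamma_i$ there is a probability measure $\nu_{x_{-i},\gamma_i}$ on $\mathcal X_i$ with $P^{m_i}_{x_{-i},\gamma_i}(x_i,\cdot)\ge s_i\,\nu_{x_{-i},\gamma_i}(\cdot)$ for every $x_i\in\mathcal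 X_i$. Then the following hold. 1. For all starting values $(x_0,\alpha_0,\gamma_0)$ for which (a) $A_n\to0$ in $\mathbb P_{x_0,\alpha_0,\gamma_0}$-probability and (d) $D_{n,i}\to0$ in $\mathbb P_{x_0,\alpha_0,\gamma_0}$-probability for every $i$, we have $T(x_0,\alpha_0,\gamma_0,n)\to0$ as $n\to\infty$. In particular, if (a) and (d) hold for all starting values, then AdapRSadapMwG is ergodic. 2. Let $G\subseteq\Gamma$ be any set of initial proposal parameters (for instance a single $\gamma_0$, or all of $\Gamma$). Suppose that, for every $\delta>0$, (a') $\sup\mathbb P_{x_0,\alpha_0,\gamma_0}(A_n\ge\delta)\to0$ and (d') $\sup\mathbb P_{x_0,\alpha_0,\gamma_0}(D_{n,i}\ge\delta)\to0$ for every $i$, where the suprema are over $x_0\in\mathcal X$, $\alpha_0\in\mathcal Y$, $\gamma_0\in G$. Then $\sup_{x_0\in\mathcal X,\,\alpha_0\in\mathcal Y,\,\gamma_0\in G}T(x_0,\alpha_0,\gamma_0,n)\to0$ as $n\to\infty$. (Where $D_{n,i}$ is not measurable, probabilities are outer probabilities.) -/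

import Mathlib

open MeasureTheory ProbabilityTheory Filter Topology
open scoped ENNReal NNReal

noncomputable section

namespace AdaptiveGibbs

/-! ### Total variation and uniform ergodicity -/

/-- Total variation distance `sup_A |μ(A) - ν(A)|` of two probability measures. -/
def tvDist {S : Type*} [MeasurableSpace S] (μ ν : Measure S) : ℝ :=
  ⨆ A : {A : Set S // MeasurableSet A}, |μ.real A.1 - ν.real A.1|

/-- `P` is uniformly ergodic with limit `π`: `‖Pⁿ(x, ·) - π‖ ≤ M ρⁿ` for all `x` and `n`, with
`M < ∞` and `ρ < 1`. Powers are with respect to composition of kernels. -/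
def UniformlyErgodic {S : Type*} [MeasurableSpace S] (P : Kernel S S) (π : Measure S) : Prop :=
  ∃ M ρ : ℝ, 0 ≤ ρ ∧ ρ < 1 ∧ ∀ (n : ℕ) (x : S), tvDist ((P ^ n) x) π ≤ M * ρ ^ n

/-! ### Selection probabilities -/

/-- The set `𝒴 = [ε, 1]^d ∩ Δ_{d-1}` of admissible selection probabilities. -/
def selectionSet (d : ℕ) (ε : ℝ) : Set (Fin d → ℝ) :=
  {α | ∀ i, α i ∈ Set.Icc ε 1} ∩ stdSimplex ℝ (Fin d)

/-- Euclidean distance `|α - α'|` of two vectors of selection probabilities. -/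
def selectionDist {d : ℕ} {ε : ℝ} (α α' : selectionSet d ε) : ℝ :=
  ‖WithLp.toLp 2 (α.1 - α'.1)‖

/-! ### Product state spaces and random scan mixtures -/

section Scan

variable {d : ℕ} {X : Fin d → Type*} [∀ i, MeasurableSpace (X i)]

/-- `x ↦ x_{-i}`. -/
def dropCoord (i : Fin d) (x : ∀ j, X j) : ∀ j : {j : Fin d // j ≠ i}, X j.1 := fun j => x j.1

lemma measurable_dropCoord (i : Fin d) : Measurable (dropCoord (X := X) i) := by
  unfold dropCoord
  fun_prop

/-- From the current state `g p`, replace the `i`-th coordinate by a draw from `κ p`. -/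
def updateKernel {P : Type*} [MeasurableSpace P] (i : Fin d) (g : P → ∀ j, X j)
    (hg : Measurable g) (κ : Kernel P (X i)) [IsSFiniteKernel κ] : Kernel P (∀ j, X j) where
  toFun p := (κ p).map (Function.update (g p) i)
  measurable' := by
    refine Measure.measurable_of_measurable_coe _ fun s hs => ?_
    have hm : Measurable fun q : P × X i => Function.update (g q.1) i q.2 := by
      refine measurable_pi_lambda _ fun j => ?_
      by_cases h : j = i
      · subst h
        simpa using measurable_snd
      · simp only [Function.update_of_ne h]
        exact (measurable_pi_apply j).comp (hg.comp measurable_fst)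
    have h : ∀ p, (κ p).map (Function.update (g p) i) s
        = κ p (Prod.mk p ⁻¹' ((fun q : P × X i => Function.update (g q.1) i q.2) ⁻¹' s)) := by
      intro p
      rw [Measure.map_apply (measurable_update (g p)) hs]
      rfl
    simp_rw [h]
    exact Kernel.measurable_kernel_prodMk_left (hm hs)

instance {P : Type*} [MeasurableSpace P] (i : Fin d) (g : P → ∀ j, X j)
    (hg : Measurable g) (κ : Kernel P (X i)) [IsMarkovKernel κ] :
    IsMarkovKernel (updateKernel i g hg κ) where
  isProbabilityMeasure p :=
    Measure.isProbabilityMeasure_map (measurable_update (g p)).aemeasurable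

/-- Random scan: choose `i` with probability `α(p)_i`, then move according to `κ i`. -/
def scanKernel {P S : Type*} [MeasurableSpace P] [MeasurableSpace S] {ε : ℝ}
    (α : P → selectionSet d ε) (hα : Measurable α) (κ : Fin d → Kernel P S) : Kernel P S where
  toFun p := ∑ i, ENNReal.ofReal ((α p).1 i) • κ i p
  measurable' := by
    refine Measure.measurable_of_measurable_coe _ fun s hs => ?_
    simp only [Measure.coe_finsetSum, Measure.coe_smul, Finset.sum_apply, Pi.smul_apply,
      smul_eq_mul]
    refine Finset.measurable_sum _ fun i _ => Measurable.mul ?_ ((κ i).measurable_coe hs)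
    exact ((measurable_pi_apply i).comp (measurable_subtype_coe.comp hα)).ennreal_ofReal

instance {P S : Type*} [MeasurableSpace P] [MeasurableSpace S] {ε : ℝ}
    (α : P → selectionSet d ε) (hα : Measurable α) (κ : Fin d → Kernel P S)
    [∀ i, IsMarkovKernel (κ i)] : IsMarkovKernel (scanKernel α hα κ) where
  isProbabilityMeasure p := by
    constructor
    change (∑ i, ENNReal.ofReal ((α p).1 i) • κ i p) Set.univ = 1
    simp only [Measure.coe_finsetSum, Measure.coe_smul, Finset.sum_apply, Pi.smul_apply,
      smul_eq_mul, measure_univ, mul_one]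
    rw [← ENNReal.ofReal_sum_of_nonneg fun i _ => (α p).2.2.1 i, (α p).2.2.2, ENNReal.ofReal_one]

end Scan

/-! ### Target distribution and Gibbs sampler -/

/-- A target probability measure `π` on `X_1 × ⋯ × X_d`, together with a version of its full
conditional distributions `π(· | x_{-i})`, given by densities with respect to σ-finite reference
measures on the coordinate spaces. -/
structure Target {d : ℕ} (X : Fin d → Type*) [∀ i, MeasurableSpace (X i)] where
  /-- the target distribution -/
  π : Measure (∀ i, X i)
  isProbabilityMeasure : IsProbabilityMeasure π
  /-- the reference measures -/
  ref : ∀ i, Measure (X i)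
  sigmaFinite : ∀ i, SigmaFinite (ref i)
  /-- the conditional density `y ↦ π(y | x_{-i})` -/
  dens : ∀ i, (∀ j : {j : Fin d // j ≠ i}, X j.1) → X i → ℝ≥0
  measurable_dens : ∀ i, Measurable (Function.uncurry (dens i))
  lintegral_dens : ∀ i x, ∫⁻ y, dens i x y ∂ref i = 1
  /-- under `π`, the conditional law of the `i`-th coordinate given the others has density `dens` -/
  hasCondDistrib : ∀ i,
    haveI := sigmaFinite i
    HasCondDistrib (fun x : ∀ j, X j => x i) (dropCoord i)
      ((Kernel.const _ (ref i)).withDensity fun x y => (dens i x y : ℝ≥0∞)) π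

namespace Target

variable {d : ℕ} {X : Fin d → Type*} [∀ i, MeasurableSpace (X i)] (T : Target X)

instance : IsProbabilityMeasure T.π := T.isProbabilityMeasure

instance (i : Fin d) : SigmaFinite (T.ref i) := T.sigmaFinite i

/-- The full conditional distribution `x_{-i} ↦ π(· | x_{-i})`. -/
def cond (i : Fin d) : Kernel (∀ j : {j : Fin d // j ≠ i}, X j.1) (X i) :=
  (Kernel.const _ (T.ref i)).withDensity fun x y => (T.dens i x y : ℝ≥0∞)

instance (i : Fin d) : IsMarkovKernel (T.cond i) where
  isProbabilityMeasure x := by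
    constructor
    rw [cond, Kernel.withDensity_apply' _ (T.measurable_dens i).coe_nnreal_ennreal]
    simpa using T.lintegral_dens i x

/-- Gibbs update of the `i`-th coordinate. -/
def gibbs (i : Fin d) : Kernel (∀ j, X j) (∀ j, X j) :=
  updateKernel i id measurable_id ((T.cond i).comap (dropCoord i) (measurable_dropCoord i))

/-- The random scan Gibbs sampler `RSG(β)`. -/
def rsg {ε : ℝ} (β : selectionSet d ε) : Kernel (∀ j, X j) (∀ j, X j) :=
  scanKernel (fun _ => β) measurable_const T.gibbs

end Target

/-! ### Metropolis updates with adaptive proposals -/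

/-- For each coordinate `i`, a family of proposals `Q_{x_{-i}, γ}(x_i, ·)`, `γ ∈ Γ i`, with density
`y ↦ q_{x_{-i}, γ}(x_i, y)` with respect to the reference measure. -/
structure Proposals {d : ℕ} {X : Fin d → Type*} [∀ i, MeasurableSpace (X i)] (T : Target X)
    (Γ : Fin d → Type*) [∀ i, MeasurableSpace (Γ i)] where
  /-- the density: `q i (x_{-i}, γ, x_i) y` is `q_{x_{-i}, γ}(x_i, y)` -/
  q : ∀ i, (∀ j : {j : Fin d // j ≠ i}, X j.1) × Γ i × X i → X i → ℝ≥0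
  measurable_q : ∀ i, Measurable (Function.uncurry (q i))
  lintegral_q : ∀ i p, ∫⁻ y, q i p y ∂T.ref i = 1

namespace Proposals

variable {d : ℕ} {X : Fin d → Type*} [∀ i, MeasurableSpace (X i)] {T : Target X}
  {Γ : Fin d → Type*} [∀ i, MeasurableSpace (Γ i)] (Q : Proposals T Γ)

/-- The Metropolis–Hastings acceptance probability
`min (1, π(y | x_{-i}) q(y, x_i) / (π(x_i | x_{-i}) q(x_i, y)))`, equal to `1` when the denominator
vanishes. -/
def accept (i : Fin d) (p : (∀ j : {j : Fin d // j ≠ i}, X j.1) × Γ i × X i) (y : X i) : ℝ≥0 :=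
  if T.dens i p.1 p.2.2 * Q.q i p y = 0 then 1
  else min 1 (T.dens i p.1 y * Q.q i (p.1, p.2.1, y) p.2.2
    / (T.dens i p.1 p.2.2 * Q.q i p y))

/-- Density of an accepted proposal. -/
def acceptedDens (i : Fin d) (p : (∀ j : {j : Fin d // j ≠ i}, X j.1) × Γ i × X i) (y : X i) :
    ℝ≥0∞ :=
  (Q.q i p y * Q.accept i p y : ℝ≥0)

/-- Probability of rejecting the proposal. -/
def rejectProb (i : Fin d) (p : (∀ j : {j : Fin d // j ≠ i}, X j.1) × Γ i × X i) : ℝ≥0∞ :=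
  1 - ∫⁻ y, Q.acceptedDens i p y ∂T.ref i

lemma measurable_acceptedDens (i : Fin d) : Measurable (Function.uncurry (Q.acceptedDens i)) := by
  have hq := Q.measurable_q i
  have hd := T.measurable_dens i
  have h1 : Measurable fun z : ((∀ j : {j : Fin d // j ≠ i}, X j.1) × Γ i × X i) × X i =>
      T.dens i z.1.1 z.1.2.2 :=
    hd.comp (measurable_fst.fst.prodMk measurable_fst.snd.snd)
  have h2 : Measurable fun z : ((∀ j : {j : Fin d // j ≠ i}, X j.1) × Γ i × X i) × X i =>
      T.dens i z.1.1 z.2 :=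
    hd.comp (measurable_fst.fst.prodMk measurable_snd)
  have h3 : Measurable fun z : ((∀ j : {j : Fin d // j ≠ i}, X j.1) × Γ i × X i) × X i =>
      Q.q i z.1 z.2 := hq
  have h4 : Measurable fun z : ((∀ j : {j : Fin d // j ≠ i}, X j.1) × Γ i × X i) × X i =>
      Q.q i (z.1.1, z.1.2.1, z.2) z.1.2.2 :=
    hq.comp ((measurable_fst.fst.prodMk (measurable_fst.snd.fst.prodMk measurable_snd)).prodMk
      measurable_fst.snd.snd)
  refine Measurable.coe_nnreal_ennreal (Measurable.mul h3 ?_)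
  exact Measurable.ite (measurableSet_eq_fun (h1.mul h3) measurable_const) measurable_const
    (measurable_const.min ((h2.mul h4).div (h1.mul h3)))

lemma measurable_rejectProb (i : Fin d) : Measurable (Q.rejectProb i) :=
  measurable_const.sub (Q.measurable_acceptedDens i).lintegral_prod_right'

/-- The Metropolis kernel `P_{x_{-i}, γ}(x_i, ·)`, as a kernel in `(x_{-i}, γ, x_i)`:
`∫_B q(x_i, y) a(x_i, y) dy + (rejection probability) · 1_B(x_i)`. -/
def metropolis (i : Fin d) :
    Kernel ((∀ j : {j : Fin d // j ≠ i}, X j.1) × Γ i × X i) (X i) where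
  toFun p := (T.ref i).withDensity (Q.acceptedDens i p) + Q.rejectProb i p • Measure.dirac p.2.2
  measurable' := by
    refine Measure.measurable_of_measurable_coe _ fun s hs => ?_
    simp only [Measure.coe_add, Measure.coe_smul, Pi.add_apply, Pi.smul_apply, smul_eq_mul,
      withDensity_apply _ hs, Measure.dirac_apply' _ hs]
    refine Measurable.add ?_ (Measurable.mul (Q.measurable_rejectProb i) ?_)
    · exact (Q.measurable_acceptedDens i).lintegral_prod_right'
    · exact (measurable_one.indicator hs).comp measurable_snd.snd

lemma lintegral_acceptedDens_le (i : Fin d)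
    (p : (∀ j : {j : Fin d // j ≠ i}, X j.1) × Γ i × X i) :
    ∫⁻ y, Q.acceptedDens i p y ∂T.ref i ≤ 1 := by
  rw [← Q.lintegral_q i p]
  refine lintegral_mono fun y => ENNReal.coe_le_coe.2 ?_
  refine mul_le_of_le_one_right' ?_
  unfold accept
  split_ifs
  · exact le_rfl
  · exact min_le_left _ _

instance (i : Fin d) : IsMarkovKernel (Q.metropolis i) where
  isProbabilityMeasure p := by
    constructor
    change ((T.ref i).withDensity (Q.acceptedDens i p)
      + Q.rejectProb i p • Measure.dirac p.2.2) Set.univ = 1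
    simp only [Measure.coe_add, Measure.coe_smul, Pi.add_apply, Pi.smul_apply, smul_eq_mul,
      withDensity_apply _ MeasurableSet.univ, measure_univ, mul_one, Measure.restrict_univ]
    exact add_tsub_cancel_of_le (Q.lintegral_acceptedDens_le i p)

/-- The Metropolis kernel `P_{x_{-i}, γ}` on `X i`, for fixed `x_{-i}` and `γ`. -/
def metropolisAt (i : Fin d) (x : ∀ j : {j : Fin d // j ≠ i}, X j.1) (γ : Γ i) :
    Kernel (X i) (X i) :=
  (Q.metropolis i).comap (fun y => (x, γ, y))
    (measurable_const.prodMk (measurable_const.prodMk measurable_id))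

/-- Every kernel `P_{x_{-i}, γ}` is uniformly ergodic, and for each `i` there is a minorisation
`P_{x_{-i}, γ}^m (y, ·) ≥ s ν_{x_{-i}, γ}` with `m` and `s > 0` not depending on `x_{-i}`, `γ`. -/
def UniformMinorisation : Prop :=
  ∀ i : Fin d,
    (∀ x (γ : Γ i), UniformlyErgodic (Q.metropolisAt i x γ) (T.cond i x)) ∧
    ∃ (s : ℝ) (m : ℕ), 0 < s ∧ ∀ x (γ : Γ i), ∃ ν : Measure (X i), IsProbabilityMeasure ν ∧
      ∀ y : X i, ENNReal.ofReal s • ν ≤ (Q.metropolisAt i x γ ^ m) y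

/-- `sup_x ‖P_{x_{-i}, γ'}(x_i, ·) - P_{x_{-i}, γ}(x_i, ·)‖`. -/
def metropolisDist (i : Fin d) (γ' γ : Γ i) : ℝ :=
  ⨆ x : ∀ j, X j, tvDist (Q.metropolisAt i (dropCoord i x) γ' (x i))
    (Q.metropolisAt i (dropCoord i x) γ (x i))

end Proposals

/-! ### The doubly adaptive sampler -/

section Sampler

variable {d : ℕ} {X : Fin d → Type*} [∀ i, MeasurableSpace (X i)] {T : Target X}
  {Γ : Fin d → Type*} [∀ i, MeasurableSpace (Γ i)]

/-- States `(X_n, α_n, γ_n)` of the adaptive algorithm. -/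
abbrev AdaptState (X Γ : Fin d → Type*) (ε : ℝ) : Type _ :=
  (∀ i, X i) × selectionSet d ε × (∀ i, Γ i)

/-- An adaptation rule: at each step `n`, the law of `(α_{n+1}, γ_{n+1})` given the whole history
`(X_k, α_k, γ_k)_{k ≤ n}`. Deterministic update functions are the case of deterministic kernels. -/
abbrev AdaptRule (X Γ : Fin d → Type*) [∀ i, MeasurableSpace (X i)] [∀ i, MeasurableSpace (Γ i)]
    (ε : ℝ) : Type _ :=
  ∀ n : ℕ, Kernel (∀ _ : Finset.Iic n, AdaptState X Γ ε) (selectionSet d ε × (∀ i, Γ i))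

/-- The random scan Metropolis-within-Gibbs kernel `P_{α, γ}(x, ·)`, as a kernel in `(x, α, γ)`. -/
def rsmwg (Q : Proposals T Γ) (ε : ℝ) : Kernel (AdaptState X Γ ε) (∀ i, X i) :=
  scanKernel (fun p => p.2.1) measurable_snd.fst fun i =>
    updateKernel i (fun p => p.1) measurable_fst
      ((Q.metropolis i).comap (fun p => (dropCoord i p.1, p.2.2 i, p.1 i))
        (((measurable_dropCoord i).comp measurable_fst).prodMk
          (((measurable_pi_apply i).comp measurable_snd.snd).prodMk
            ((measurable_pi_apply i).comp measurable_fst))))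

instance (Q : Proposals T Γ) (ε : ℝ) : IsMarkovKernel (rsmwg Q ε) := by
  unfold rsmwg
  infer_instance

variable {ε : ℝ}

/-- One step of the algorithm: given the history up to time `n`, draw `(α_{n+1}, γ_{n+1})` from the
adaptation rule and then `X_{n+1}` from `P_{α_{n+1}, γ_{n+1}}(X_n, ·)`. -/
def stepKernel (Q : Proposals T Γ) (R : AdaptRule X Γ ε) (n : ℕ) :
    Kernel (∀ _ : Finset.Iic n, AdaptState X Γ ε) (AdaptState X Γ ε) :=
  (R n ⊗ₖ (rsmwg Q ε).comap (fun p => ((p.1 ⟨n, Finset.mem_Iic.2 le_rfl⟩).1, p.2))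
    ((((measurable_pi_apply _).comp measurable_fst).fst).prodMk measurable_snd)).map Prod.swap

/-- One step of the algorithm is a Markov kernel. -/
instance (Q : Proposals T Γ) (R : AdaptRule X Γ ε) [∀ n, IsMarkovKernel (R n)] (n : ℕ) :
    IsMarkovKernel (stepKernel Q R n) := by
  unfold stepKernel
  exact Kernel.IsMarkovKernel.map _ measurable_swap

/-- The law of the trajectory `(X_n, α_n, γ_n)_{n ≥ 0}` of the doubly adaptive sampler
`AdapRSadapMwG` started at `(x_0, α_0, γ_0)`. -/
def trajLaw (Q : Proposals T Γ) (R : AdaptRule X Γ ε) [∀ n, IsMarkovKernel (R n)]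
    (s : AdaptState X Γ ε) : Measure (ℕ → AdaptState X Γ ε) :=
  Kernel.traj (X := fun _ => AdaptState X Γ ε) (stepKernel Q R) 0 fun _ => s

/-- `T(x_0, α_0, γ_0, n) = ‖Law(X_n) - π‖`. -/
def distToTarget (Q : Proposals T Γ) (R : AdaptRule X Γ ε) [∀ n, IsMarkovKernel (R n)]
    (s : AdaptState X Γ ε) (n : ℕ) : ℝ :=
  tvDist ((trajLaw Q R s).map fun ω => (ω n).1) T.π

/-- `|α_{n+1} - α_n|` along a trajectory. -/
def selectionIncrement (n : ℕ) (ω : ℕ → AdaptState X Γ ε) : ℝ :=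
  selectionDist (ω (n + 1)).2.1 (ω n).2.1

/-- `sup_x ‖P_{x_{-i}, γ_{n+1,i}}(x_i, ·) - P_{x_{-i}, γ_{n,i}}(x_i, ·)‖` along a trajectory. -/
def metropolisIncrement (Q : Proposals T Γ) (i : Fin d) (n : ℕ) (ω : ℕ → AdaptState X Γ ε) : ℝ :=
  Q.metropolisDist i ((ω (n + 1)).2.2 i) ((ω n).2.2 i)

/-- `D_n → 0` in probability, uniformly over the starting values in `S`:
`sup_{s ∈ S} ℙ_s(|D_n| ≥ δ) → 0` for every `δ > 0`. -/
def TendstoZeroInProbUniformly (Q : Proposals T Γ) (R : AdaptRule X Γ ε)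
    [∀ n, IsMarkovKernel (R n)] (S : Set (AdaptState X Γ ε))
    (D : ℕ → (ℕ → AdaptState X Γ ε) → ℝ) : Prop :=
  ∀ δ : ℝ, 0 < δ →
    Tendsto (fun n => ⨆ s ∈ S, trajLaw Q R s {ω | δ ≤ |D n ω|}) atTop (𝓝 0)

end Sampler

end AdaptiveGibbs

end

/-! The argument combines simultaneous ergodicity of all frozen kernels with diminishing adaptation.

Frozen parameters. The Metropolis kernels are reversible, and a reversible kernel with `K ≥ s ν`
satisfies `K² ≥ s² π`. So the parameter-dependent minorising measures in (c) can be replaced by the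
full conditionals: some power `N` of every coordinate kernel dominates `c` times a Gibbs draw
(`Proposals.UniformMinorisation.exists_smul_cond_le`). Since each coordinate is selected with
probability at least `ε`, the `N`-th power of every Metropolis-within-Gibbs kernel dominates a fixed
multiple of `RSG(β)` (`Proposals.exists_smul_rsg_le`). Uniform ergodicity of `RSG(β)` then yields
one Dobrushin coefficient below 1 for a fixed power of all these kernels. As they all preserve `π`,
a single `n` brings them within `η` of `π`, for every parameter and every starting point
(`Proposals.exists_forall_rsmwgAt_pow_le`).

Adaptation. The adaptive chain on a window `[K, K + n]` is compared with the chain whose parameters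
are frozen at their time-`K` values. Outside the event that some increment in the window is at least
`δ`, each step costs at most a multiple of `n δ` (`lintegral_rsmwgAt_pow_le`). With `n` fixed, one
takes `δ` small and then `K` large. No bound depends on the state at time `K`, so uniformity over
starting values is needed only in the increments. -/

namespace AdaptiveGibbs

/-! ### One-sided comparison of measures -/

section Comparison

variable {S : Type*} [MeasurableSpace S]

/-- Layer cake: each superlevel set costs `c`, and only levels in `(0, r]` contribute. -/
lemma lintegral_le_lintegral_add_mul {μ ν : Measure S} {c r : ℝ≥0∞}
    (h : ∀ B, MeasurableSet B → μ B ≤ ν B + c) {g : S → ℝ≥0∞} (hg : Measurable g) (hr : r ≠ ∞)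
    (hgr : ∀ x, g x ≤ r) : ∫⁻ x, g x ∂μ ≤ ∫⁻ x, g x ∂ν + r * c := by
  have hf : Measurable fun x => (g x).toReal := hg.ennreal_toReal
  have hof : ∀ x, g x = ENNReal.ofReal (g x).toReal := fun x =>
    (ENNReal.ofReal_toReal (ne_top_of_le_ne_top hr (hgr x))).symm
  have hlayer : ∀ τ : Measure S,
      ∫⁻ x, g x ∂τ = ∫⁻ t in Set.Ioi (0 : ℝ), τ {x | t ≤ (g x).toReal} := fun τ => by
    rw [← lintegral_eq_lintegral_meas_le τ (ae_of_all _ fun _ => ENNReal.toReal_nonneg)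
      hf.aemeasurable]
    exact lintegral_congr hof
  rw [hlayer μ, hlayer ν]
  calc ∫⁻ t in Set.Ioi (0 : ℝ), μ {x | t ≤ (g x).toReal}
      ≤ ∫⁻ t in Set.Ioi (0 : ℝ), (ν {x | t ≤ (g x).toReal}
          + (Set.Iic r.toReal).indicator (fun _ => c) t) := by
        refine lintegral_mono fun t => ?_
        by_cases ht : t ≤ r.toReal
        · rw [Set.indicator_of_mem (Set.mem_Iic.2 ht)]
          exact h _ (measurableSet_le measurable_const hf)
        · have : {x | t ≤ (g x).toReal} = ∅ := by
            ext x
            simp only [Set.mem_ofPred_eq, Set.mem_empty_iff_false, iff_false]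
            exact fun hx => ht (hx.trans (ENNReal.toReal_mono hr (hgr x)))
          simp [this]
    _ = (∫⁻ t in Set.Ioi (0 : ℝ), ν {x | t ≤ (g x).toReal}) + r * c := by
        rw [lintegral_add_right _ (measurable_const.indicator measurableSet_Iic),
          lintegral_indicator measurableSet_Iic, Measure.restrict_restrict measurableSet_Iic,
          setLIntegral_const, Set.inter_comm, Set.Ioi_inter_Iic, Real.volume_Ioc, sub_zero,
          ENNReal.ofReal_toReal hr, mul_comm]

/-- A constant has the same integral under both probability measures, so only the oscillation `r` is
charged. This is what makes the Dobrushin coefficients multiply. -/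
lemma lintegral_le_lintegral_add_osc {μ ν : Measure S} [IsProbabilityMeasure μ]
    [IsProbabilityMeasure ν] {a c r : ℝ≥0∞}
    (h : ∀ B, MeasurableSet B → μ B ≤ ν B + c) {g : S → ℝ≥0∞} (hg : Measurable g) (hr : r ≠ ∞)
    (hag : ∀ x, a ≤ g x) (hgr : ∀ x, g x ≤ a + r) : ∫⁻ x, g x ∂μ ≤ ∫⁻ x, g x ∂ν + r * c := by
  have hsplit : ∀ (τ : Measure S) [IsProbabilityMeasure τ],
      ∫⁻ x, g x ∂τ = a + ∫⁻ x, (g x - a) ∂τ := fun τ _ => by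
    rw [← lintegral_congr fun x => add_tsub_cancel_of_le (hag x),
      lintegral_add_left measurable_const]
    simp
  rw [hsplit μ, hsplit ν, add_assoc]
  gcongr
  exact lintegral_le_lintegral_add_mul h (hg.sub measurable_const) hr
    fun x => tsub_le_iff_left.2 (hgr x)

lemma abs_measureReal_sub_le_one (μ ν : Measure S) [IsProbabilityMeasure μ] [IsProbabilityMeasure ν]
    (A : Set S) : |μ.real A - ν.real A| ≤ 1 := by
  have h1 := measureReal_nonneg (μ := μ) (s := A)
  have h2 := measureReal_nonneg (μ := ν) (s := A)
  have h3 := measureReal_le_one (μ := μ) (s := A)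
  have h4 := measureReal_le_one (μ := ν) (s := A)
  rw [abs_le]
  constructor <;> linarith

lemma abs_sub_le_tvDist (μ ν : Measure S) [IsProbabilityMeasure μ] [IsProbabilityMeasure ν]
    {A : Set S} (hA : MeasurableSet A) : |μ.real A - ν.real A| ≤ tvDist μ ν :=
  le_ciSup (f := fun A : {A : Set S // MeasurableSet A} => |μ.real A.1 - ν.real A.1|)
    ⟨1, by rintro _ ⟨A, rfl⟩; exact abs_measureReal_sub_le_one μ ν A.1⟩ ⟨A, hA⟩

lemma tvDist_nonneg (μ ν : Measure S) : 0 ≤ tvDist μ ν := Real.iSup_nonneg fun _ => abs_nonneg _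

/-- Complements supply the reverse inequality, so one-sided bounds in `ℝ≥0∞` suffice for the whole
argument. -/
lemma tvDist_le_of_one_sided {μ ν : Measure S} [IsProbabilityMeasure μ] [IsProbabilityMeasure ν]
    {c : ℝ} (hc : 0 ≤ c) (h : ∀ B, MeasurableSet B → μ B ≤ ν B + ENNReal.ofReal c) :
    tvDist μ ν ≤ c := by
  have h' : ∀ B, MeasurableSet B → μ.real B ≤ ν.real B + c := fun B hB => by
    have := ENNReal.toReal_mono (by finiteness) (h B hB)
    rwa [ENNReal.toReal_add (by finiteness) (by finiteness), ENNReal.toReal_ofReal hc] at this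
  refine Real.iSup_le (fun A => ?_) hc
  have h1 := h' _ A.2
  have h2 := h' _ A.2.compl
  rw [probReal_compl_eq_one_sub A.2, probReal_compl_eq_one_sub A.2] at h2
  rw [abs_le]
  constructor <;> linarith

end Comparison

/-! ### Powers of Markov kernels -/

section Powers

variable {S : Type*} [MeasurableSpace S]

lemma isMarkovKernel_pow (K : Kernel S S) [IsMarkovKernel K] (n : ℕ) : IsMarkovKernel (K ^ n) := by
  induction n with
  | zero => rw [pow_zero]; exact inferInstanceAs (IsMarkovKernel Kernel.id)
  | succ n ih => rw [pow_succ]; exact inferInstanceAs (IsMarkovKernel ((K ^ n) ∘ₖ K))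

lemma pow_succ_apply' (K : Kernel S S) (n : ℕ) (x : S) {B : Set S} (hB : MeasurableSet B) :
    (K ^ (n + 1)) x B = ∫⁻ z, (K ^ n) z B ∂K x := by
  rw [pow_succ]
  exact Kernel.comp_apply' _ _ _ hB

lemma smul_pow_le_pow {U K : Kernel S S} {a : ℝ≥0∞} (h : ∀ x, a • U x ≤ K x) (n : ℕ) (x : S) :
    a ^ n • (U ^ n) x ≤ (K ^ n) x := by
  induction n generalizing x with
  | zero => simp
  | succ n ih =>
    refine Measure.le_iff.2 fun B hB => ?_
    rw [Measure.smul_apply, smul_eq_mul, pow_succ_apply' _ _ _ hB, pow_succ_apply' _ _ _ hB]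
    calc a ^ (n + 1) * ∫⁻ z, (U ^ n) z B ∂U x
        = ∫⁻ z, a ^ n * (U ^ n) z B ∂(a • U x) := by
          rw [lintegral_smul_measure, lintegral_const_mul _ ((U ^ n).measurable_coe hB), pow_succ,
            smul_eq_mul]
          ring
      _ ≤ ∫⁻ z, (K ^ n) z B ∂K x := lintegral_mono' (h x) fun z => by
          have := Measure.le_iff.1 (ih z) B hB
          rwa [Measure.smul_apply, smul_eq_mul] at this

/-- A lower bound valid from every state survives any number of preliminary steps; this permits one
exponent for all coordinates. -/
lemma smul_le_pow_of_le {K : Kernel S S} [IsMarkovKernel K] {c : ℝ≥0∞} {τ : Measure S} {m n : ℕ}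
    (hmn : m ≤ n) (h : ∀ y, c • τ ≤ (K ^ m) y) (y : S) : c • τ ≤ (K ^ n) y := by
  obtain ⟨k, rfl⟩ := Nat.exists_eq_add_of_le' hmn
  refine Measure.le_iff.2 fun B hB => ?_
  rw [Kernel.pow_add_apply_eq_lintegral _ _ _ _ hB]
  have := isMarkovKernel_pow K k
  calc (c • τ) B = ∫⁻ _, (c • τ) B ∂(K ^ k) y := by simp
    _ ≤ _ := lintegral_mono fun z => Measure.le_iff.1 (h z) B hB

/-- Contraction of the oscillation by a kernel with Dobrushin coefficient at most `c`. -/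
lemma pow_apply_le_pow_apply_add {K : Kernel S S} [IsMarkovKernel K] {c : ℝ≥0∞} (hc : c ≠ ∞)
    (h : ∀ x y B, MeasurableSet B → K x B ≤ K y B + c) (n : ℕ) (x y : S) {B : Set S}
    (hB : MeasurableSet B) : (K ^ n) x B ≤ (K ^ n) y B + c ^ n := by
  induction n generalizing x y with
  | zero =>
    rw [pow_zero, pow_zero]
    have : IsMarkovKernel (1 : Kernel S S) := inferInstanceAs (IsMarkovKernel Kernel.id)
    exact prob_le_one.trans le_add_self
  | succ n ih =>
    rw [pow_succ_apply' _ _ _ hB, pow_succ_apply' _ _ _ hB, pow_succ]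
    have : Nonempty S := ⟨x⟩
    -- The induction hypothesis says that `z ↦ (K ^ n) z B` exceeds its infimum by at most `c ^ n`.
    refine lintegral_le_lintegral_add_osc (a := ⨅ z, (K ^ n) z B) (h x y)
      ((K ^ n).measurable_coe hB) (by finiteness) (fun z => iInf_le _ z) fun z => ?_
    rw [ENNReal.iInf_add]
    exact le_iInf fun w => ih z w

end Powers

/-! ### Symmetric kernels -/

section Symmetric

variable {S : Type*} [MeasurableSpace S]

/-- `K` is symmetric in `L²(π)`, i.e. reversible with respect to `π`. -/
def SymmetricKernel (K : Kernel S S) (π : Measure S) : Prop :=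
  ∀ f g : S → ℝ≥0∞, Measurable f → Measurable g →
    ∫⁻ y, f y * ∫⁻ w, g w ∂K y ∂π = ∫⁻ y, g y * ∫⁻ w, f w ∂K y ∂π

lemma SymmetricKernel.pow {K : Kernel S S} {π : Measure S} (h : SymmetricKernel K π) (n : ℕ) :
    SymmetricKernel (K ^ n) π := by
  induction n with
  | zero =>
    intro f g hf hg
    have h1 : ∀ (k : S → ℝ≥0∞), Measurable k → ∀ y, ∫⁻ w, k w ∂((K ^ 0) y) = k y :=
      fun k hk y => by
        rw [pow_zero]
        change ∫⁻ w, k w ∂(Kernel.id y) = k y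
        rw [Kernel.id_apply, lintegral_dirac' _ hk]
    simp_rw [h1 f hf, h1 g hg, mul_comm]
  | succ n ih =>
    intro f g hf hg
    -- The single step is split off first on one side and last on the other, so that `h` and `ih`
    -- each move one factor across.
    have h1 : ∀ y, ∫⁻ w, g w ∂((K ^ (n + 1)) y) = ∫⁻ z, ∫⁻ w, g w ∂((K ^ n) z) ∂K y := fun y => by
      rw [pow_succ]
      exact Kernel.lintegral_comp _ _ _ hg
    have h2 : ∀ y, ∫⁻ w, f w ∂((K ^ (n + 1)) y) = ∫⁻ z, ∫⁻ w, f w ∂K z ∂((K ^ n) y) := fun y => by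
      rw [pow_succ']
      exact Kernel.lintegral_comp _ _ _ hf
    simp_rw [h1, h2]
    rw [h f _ hf hg.lintegral_kernel,
      lintegral_congr fun y => mul_comm (∫⁻ w, g w ∂((K ^ n) y)) (∫⁻ w, f w ∂K y),
      ih _ g hf.lintegral_kernel hg]

/-- Symmetry tested against the constant 1 gives invariance. -/
lemma SymmetricKernel.lintegral_apply {K : Kernel S S} [IsMarkovKernel K] {π : Measure S}
    (h : SymmetricKernel K π) {B : Set S} (hB : MeasurableSet B) : ∫⁻ y, K y B ∂π = π B := by
  have := h 1 (B.indicator 1) measurable_one (measurable_one.indicator hB)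
  simpa [lintegral_indicator_one hB] using this

/-- With `f = dν/dπ` the integral is `∫ f² dπ`, and `2 f ≤ f² + 1` integrates to `2 ≤ ∫ f² dπ + 1`.
-/
lemma one_le_lintegral_rnDeriv {ν π : Measure S} [IsProbabilityMeasure ν] [IsProbabilityMeasure π]
    (h : ν ≪ π) : 1 ≤ ∫⁻ y, ν.rnDeriv π y ∂ν := by
  have hf := Measure.measurable_rnDeriv ν π
  have h1 : ∫⁻ y, ν.rnDeriv π y ∂π = 1 := by
    rw [Measure.lintegral_rnDeriv h, measure_univ]
  rw [← lintegral_rnDeriv_mul h hf.aemeasurable]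
  have h2 : ∫⁻ y, 2 * ν.rnDeriv π y ∂π ≤ ∫⁻ y, (ν.rnDeriv π y * ν.rnDeriv π y + 1) ∂π := by
    refine lintegral_mono fun y => ?_
    generalize ν.rnDeriv π y = t
    induction t with
    | top => simp
    | coe t =>
      norm_cast
      rw [ENNReal.coe_le_coe, ← NNReal.coe_le_coe]
      push_cast
      nlinarith [sq_nonneg ((t : ℝ) - 1)]
  rw [lintegral_const_mul _ hf, h1, lintegral_add_right _ measurable_const] at h2
  simp only [mul_one, lintegral_const, measure_univ] at h2
  rw [← one_add_one_eq_two] at h2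
  exact (ENNReal.add_le_add_iff_right ENNReal.one_ne_top).1 h2

/-- A symmetric kernel with a minorisation `K ≥ s ν` satisfies `K² ≥ s² π`. -/
lemma SymmetricKernel.smul_le_comp_self {K : Kernel S S} [IsMarkovKernel K] {π ν : Measure S}
    [IsProbabilityMeasure π] [IsProbabilityMeasure ν] (h : SymmetricKernel K π) {s : ℝ≥0∞}
    (hs : s ≠ 0) (hν : ∀ y, s • ν ≤ K y) (y : S) : (s * s) • π ≤ (K ∘ₖ K) y := by
  have hac : ν ≪ π := by
    refine Measure.AbsolutelyContinuous.mk fun A hA hπA => ?_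
    have h1 : s * ν A ≤ π A := by
      calc s * ν A = ∫⁻ _, (s • ν) A ∂π := by simp
        _ ≤ ∫⁻ y, K y A ∂π := lintegral_mono fun y => Measure.le_iff.1 (hν y) A hA
        _ = π A := h.lintegral_apply hA
    rw [hπA, nonpos_iff_eq_zero, mul_eq_zero] at h1
    exact h1.resolve_left hs
  have hf := Measure.measurable_rnDeriv ν π
  refine Measure.le_iff.2 fun B hB => ?_
  -- With `f = dν/dπ`, symmetry turns `∫ K z B dν` into the integral of `K f` over `B` with respect
  -- to `π`, and `K f ≥ s ∫ f dν ≥ s`. One further use of `K ≥ s ν` then gives `K² ≥ s² π`.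
  have hlow : s * π B ≤ ∫⁻ z, K z B ∂ν := by
    have hsymm := h (ν.rnDeriv π) (B.indicator 1) hf (measurable_one.indicator hB)
    simp only [lintegral_indicator_one hB] at hsymm
    rw [← lintegral_rnDeriv_mul hac (K.measurable_coe hB).aemeasurable, hsymm]
    calc s * π B = ∫⁻ y, B.indicator 1 y * s ∂π := by
          rw [lintegral_mul_const _ (measurable_one.indicator hB), lintegral_indicator_one hB,
            mul_comm]
      _ ≤ _ := by
          refine lintegral_mono fun y => ?_
          gcongr
          calc s ≤ s * ∫⁻ w, ν.rnDeriv π w ∂ν :=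
                le_mul_of_one_le_right' (one_le_lintegral_rnDeriv hac)
            _ = ∫⁻ w, ν.rnDeriv π w ∂(s • ν) := by rw [lintegral_smul_measure, smul_eq_mul]
            _ ≤ _ := lintegral_mono' (hν y) le_rfl
  rw [Kernel.comp_apply' _ _ _ hB, Measure.smul_apply, smul_eq_mul]
  calc s * s * π B ≤ s * ∫⁻ z, K z B ∂ν := by rw [mul_assoc]; gcongr
    _ = ∫⁻ z, K z B ∂(s • ν) := by rw [lintegral_smul_measure, smul_eq_mul]
    _ ≤ _ := lintegral_mono' (hν y) le_rfl

end Symmetric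

/-! ### Detailed balance and minorisation by the full conditionals -/

section Reversibility

variable {d : ℕ} {X : Fin d → Type*} [∀ i, MeasurableSpace (X i)] {T : Target X}
  {Γ : Fin d → Type*} [∀ i, MeasurableSpace (Γ i)]

lemma Target.cond_apply (T : Target X) (i : Fin d) (x : ∀ j : {j : Fin d // j ≠ i}, X j.1) :
    T.cond i x = (T.ref i).withDensity fun y => (T.dens i x y : ℝ≥0∞) := by
  rw [Target.cond, Kernel.withDensity_apply _ (T.measurable_dens i).coe_nnreal_ennreal]
  rfl

/-- The accepted flow is a minimum symmetric in `y` and `w`. The convention of acceptance 1 at a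
vanishing denominator is harmless, since both sides are then 0. -/
lemma Proposals.dens_mul_acceptedDens (Q : Proposals T Γ) (i : Fin d)
    (x : ∀ j : {j : Fin d // j ≠ i}, X j.1) (γ : Γ i) (y w : X i) :
    (T.dens i x y : ℝ≥0∞) * Q.acceptedDens i (x, γ, y) w
      = (min (T.dens i x y * Q.q i (x, γ, y) w) (T.dens i x w * Q.q i (x, γ, w) y) : ℝ≥0) := by
  rw [acceptedDens, ← ENNReal.coe_mul, ENNReal.coe_inj, accept, ← mul_assoc]
  dsimp only
  split_ifs with h
  · simp [h]
  · rw [mul_min, mul_one, mul_div_cancel₀ _ h]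

lemma Proposals.dens_mul_acceptedDens_comm (Q : Proposals T Γ) (i : Fin d)
    (x : ∀ j : {j : Fin d // j ≠ i}, X j.1) (γ : Γ i) (y w : X i) :
    (T.dens i x y : ℝ≥0∞) * Q.acceptedDens i (x, γ, y) w
      = T.dens i x w * Q.acceptedDens i (x, γ, w) y := by
  rw [dens_mul_acceptedDens, dens_mul_acceptedDens, min_comm]

instance (Q : Proposals T Γ) (i : Fin d) (x : ∀ j : {j : Fin d // j ≠ i}, X j.1) (γ : Γ i) :
    IsMarkovKernel (Q.metropolisAt i x γ) := by
  unfold Proposals.metropolisAt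
  infer_instance

lemma Proposals.measurable_acceptedDens_prod (Q : Proposals T Γ) (i : Fin d)
    (x : ∀ j : {j : Fin d // j ≠ i}, X j.1) (γ : Γ i) :
    Measurable fun z : X i × X i => Q.acceptedDens i (x, γ, z.1) z.2 :=
  (Q.measurable_acceptedDens i).comp
    ((measurable_const.prodMk (measurable_const.prodMk measurable_fst)).prodMk measurable_snd)

lemma Proposals.lintegral_metropolisAt (Q : Proposals T Γ) (i : Fin d)
    (x : ∀ j : {j : Fin d // j ≠ i}, X j.1) (γ : Γ i) (y : X i) {g : X i → ℝ≥0∞}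
    (hg : Measurable g) :
    ∫⁻ w, g w ∂Q.metropolisAt i x γ y
      = ∫⁻ w, Q.acceptedDens i (x, γ, y) w * g w ∂T.ref i + Q.rejectProb i (x, γ, y) * g y := by
  have hm : Measurable (Q.acceptedDens i (x, γ, y)) :=
    (Q.measurable_acceptedDens_prod i x γ).comp measurable_prodMk_left
  change ∫⁻ w, g w ∂((T.ref i).withDensity (Q.acceptedDens i (x, γ, y))
    + Q.rejectProb i (x, γ, y) • Measure.dirac y) = _
  rw [lintegral_add_measure, lintegral_smul_measure, lintegral_dirac' _ hg,
    lintegral_withDensity_eq_lintegral_mul _ hm hg]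
  rfl

/-- Detailed balance for the Metropolis kernels. -/
lemma Proposals.symmetricKernel_metropolisAt (Q : Proposals T Γ) (i : Fin d)
    (x : ∀ j : {j : Fin d // j ≠ i}, X j.1) (γ : Γ i) :
    SymmetricKernel (Q.metropolisAt i x γ) (T.cond i x) := by
  have hd : Measurable fun y => (T.dens i x y : ℝ≥0∞) :=
    ((T.measurable_dens i).comp measurable_prodMk_left).coe_nnreal_ennreal
  have ha := Q.measurable_acceptedDens_prod i x γ
  have hr : Measurable fun y => Q.rejectProb i (x, γ, y) :=
    (Q.measurable_rejectProb i).comp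
      (measurable_const.prodMk (measurable_const.prodMk measurable_id))
  -- The accepted part becomes a double integral with symmetric weight; the rejected part lives on
  -- the diagonal and is symmetric in `f` and `g` already.
  have key : ∀ f g : X i → ℝ≥0∞, Measurable f → Measurable g →
      ∫⁻ y, f y * ∫⁻ w, g w ∂Q.metropolisAt i x γ y ∂T.cond i x
        = ∫⁻ y, ∫⁻ w, T.dens i x y * Q.acceptedDens i (x, γ, y) w * (f y * g w) ∂T.ref i ∂T.ref i
          + ∫⁻ y, T.dens i x y * (Q.rejectProb i (x, γ, y) * (f y * g y)) ∂T.ref i := by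
    intro f g hf hg
    have hfg : Measurable fun y => f y * ∫⁻ w, g w ∂Q.metropolisAt i x γ y :=
      hf.mul hg.lintegral_kernel
    have hrej : Measurable fun y =>
        (T.dens i x y : ℝ≥0∞) * (Q.rejectProb i (x, γ, y) * (f y * g y)) :=
      hd.mul (hr.mul (hf.mul hg))
    rw [Target.cond_apply, lintegral_withDensity_eq_lintegral_mul _ hd hfg,
      ← lintegral_add_right _ hrej]
    refine lintegral_congr fun y => ?_
    have hm : Measurable fun w => Q.acceptedDens i (x, γ, y) w * g w :=
      (ha.comp measurable_prodMk_left).mul hg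
    simp only [Pi.mul_apply]
    rw [Q.lintegral_metropolisAt i x γ y hg, mul_add, mul_add, ← lintegral_const_mul _ hm,
      ← lintegral_const_mul _ (hm.const_mul _)]
    congr 1
    · exact lintegral_congr fun w => by ring
    · ring
  intro f g hf hg
  rw [key f g hf hg, key g f hg hf, lintegral_lintegral_swap]
  · congr 1
    · refine lintegral_congr fun y => lintegral_congr fun w => ?_
      rw [Q.dens_mul_acceptedDens_comm i x γ w y, mul_comm (f w)]
    · exact lintegral_congr fun y => by rw [mul_comm (f y)]
  · refine Measurable.aemeasurable ?_
    exact ((hd.comp measurable_fst).mul ha).mul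
      ((hf.comp measurable_fst).mul (hg.comp measurable_snd))

/-- The Metropolis kernels satisfy a minorisation by the full conditional distributions that is
uniform in all parameters. -/
lemma Proposals.UniformMinorisation.exists_smul_cond_le {Q : Proposals T Γ}
    (hc : Q.UniformMinorisation) : ∃ (N : ℕ) (c : ℝ≥0∞), c ≠ 0 ∧
      ∀ i x (γ : Γ i) y, c • T.cond i x ≤ (Q.metropolisAt i x γ ^ N) y := by
  choose s m hs hν using fun i => (hc i).2
  -- Doubling `m i` and squaring `s i` come from `SymmetricKernel.smul_le_comp_self`; the sum and
  -- the infimum make them independent of `i`. An empty index set would give the constant `∞`.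
  refine ⟨∑ i, (m i + m i), Finset.univ.inf fun i => ENNReal.ofReal (s i) * ENNReal.ofReal (s i),
    ?_, fun i x γ y => ?_⟩
  · rw [← pos_iff_ne_zero, Finset.lt_inf_iff ENNReal.zero_lt_top]
    intro i _
    have := ENNReal.ofReal_pos.2 (hs i)
    positivity
  · obtain ⟨ν, hprob, hmin⟩ := hν i x γ
    have := isMarkovKernel_pow (Q.metropolisAt i x γ) (m i)
    refine smul_le_pow_of_le (Finset.single_le_sum (f := fun i => m i + m i)
      (fun _ _ => Nat.zero_le _) (Finset.mem_univ i)) (fun z => ?_) y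
    refine le_trans ?_ ((((Q.symmetricKernel_metropolisAt i x γ).pow (m i)).smul_le_comp_self
      (ENNReal.ofReal_pos.2 (hs i)).ne' hmin z).trans_eq ?_)
    · refine Measure.le_iff.2 fun B _ => ?_
      simp only [Measure.smul_apply, smul_eq_mul]
      gcongr
      exact Finset.inf_le (Finset.mem_univ i)
    · rw [Kernel.pow_add]

end Reversibility

/-! ### Metropolis within Gibbs for fixed parameters -/

section Coordinates

variable {d : ℕ} {X : Fin d → Type*}

lemma dropCoord_update (i : Fin d) (x : ∀ j, X j) (y : X i) :
    dropCoord i (Function.update x i y) = dropCoord i x := by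
  funext j
  simp [dropCoord, Function.update_of_ne j.2]

/-- The state with `i`-th coordinate `w` and other coordinates `u`. -/
def glue (i : Fin d) (p : (∀ j : {j : Fin d // j ≠ i}, X j.1) × X i) : ∀ j, X j :=
  fun j => if h : j = i then h.symm ▸ p.2 else p.1 ⟨j, h⟩

lemma glue_dropCoord (i : Fin d) (x : ∀ j, X j) (w : X i) :
    glue i (dropCoord i x, w) = Function.update x i w := by
  funext j
  by_cases h : j = i
  · subst h
    simp [glue]
  · simp [glue, h, dropCoord]

end Coordinates

section FixedParameters

variable {d : ℕ} {X : Fin d → Type*} [∀ i, MeasurableSpace (X i)] {T : Target X}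
  {Γ : Fin d → Type*} [∀ i, MeasurableSpace (Γ i)]

lemma scanKernel_apply {P S : Type*} [MeasurableSpace P] [MeasurableSpace S] {ε : ℝ}
    (α : P → selectionSet d ε) (hα : Measurable α) (κ : Fin d → Kernel P S) (p : P) :
    scanKernel α hα κ p = ∑ i, ENNReal.ofReal ((α p).1 i) • κ i p := rfl

lemma sum_ofReal_selection {ε : ℝ} (α : selectionSet d ε) :
    ∑ i, ENNReal.ofReal (α.1 i) = 1 := by
  rw [← ENNReal.ofReal_sum_of_nonneg fun i _ => α.2.2.1 i, α.2.2.2, ENNReal.ofReal_one]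

/-- Metropolis update of the `i`-th coordinate with proposal parameter `γ`. -/
noncomputable def Proposals.mwg (Q : Proposals T Γ) (i : Fin d) (γ : Γ i) :
    Kernel (∀ j, X j) (∀ j, X j) :=
  updateKernel i id measurable_id ((Q.metropolis i).comap (fun x => (dropCoord i x, γ, x i))
    ((measurable_dropCoord i).prodMk (measurable_const.prodMk (measurable_pi_apply i))))

instance (Q : Proposals T Γ) (i : Fin d) (γ : Γ i) : IsMarkovKernel (Q.mwg i γ) := by
  unfold Proposals.mwg
  infer_instance

lemma Proposals.mwg_apply (Q : Proposals T Γ) (i : Fin d) (γ : Γ i) (x : ∀ j, X j) :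
    Q.mwg i γ x = (Q.metropolisAt i (dropCoord i x) γ (x i)).map (Function.update x i) := rfl

lemma Target.gibbs_apply (T : Target X) (i : Fin d) (x : ∀ j, X j) :
    T.gibbs i x = (T.cond i (dropCoord i x)).map (Function.update x i) := rfl

/-- The random scan Metropolis-within-Gibbs kernel with fixed parameters `θ = (α, γ)`. -/
noncomputable def Proposals.rsmwgAt (Q : Proposals T Γ) {ε : ℝ}
    (θ : selectionSet d ε × (∀ i, Γ i)) : Kernel (∀ j, X j) (∀ j, X j) :=
  (rsmwg Q ε).comap (fun x => (x, θ)) measurable_prodMk_right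

instance (Q : Proposals T Γ) {ε : ℝ} (θ : selectionSet d ε × (∀ i, Γ i)) :
    IsMarkovKernel (Q.rsmwgAt θ) := by
  unfold Proposals.rsmwgAt
  infer_instance

lemma Proposals.rsmwgAt_apply (Q : Proposals T Γ) {ε : ℝ} (θ : selectionSet d ε × (∀ i, Γ i))
    (x : ∀ j, X j) :
    Q.rsmwgAt θ x = ∑ i, ENNReal.ofReal (θ.1.1 i) • Q.mwg i (θ.2 i) x := rfl

/-- Updating coordinate `i` leaves `x_{-i}` unchanged, so the iterates follow a single
one-coordinate chain. -/
lemma Proposals.mwg_pow_apply (Q : Proposals T Γ) (i : Fin d) (γ : Γ i) (n : ℕ) (x : ∀ j, X j) :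
    (Q.mwg i γ ^ n) x
      = ((Q.metropolisAt i (dropCoord i x) γ ^ n) (x i)).map (Function.update x i) := by
  induction n generalizing x with
  | zero =>
    rw [pow_zero, pow_zero]
    change Kernel.id x = (Kernel.id (x i)).map (Function.update x i)
    rw [Kernel.id_apply, Kernel.id_apply, Measure.map_dirac' (measurable_update x),
      Function.update_eq_self]
  | succ n ih =>
    ext B hB
    have hx := measurable_update (a := i) x
    rw [Measure.map_apply hx hB, pow_succ_apply' _ _ _ hB, pow_succ_apply' _ _ _ (hx hB),
      Q.mwg_apply, lintegral_map ((Q.mwg i γ ^ n).measurable_coe hB) hx]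
    refine lintegral_congr fun y => ?_
    rw [ih, dropCoord_update, Measure.map_apply (measurable_update _) hB, Function.update_self]
    simp only [Set.preimage, Function.update_idem]

lemma measurable_glue (i : Fin d) : Measurable (glue (X := X) i) := by
  refine measurable_pi_lambda _ fun j => ?_
  by_cases h : j = i
  · subst h
    simpa [glue] using measurable_snd
  · simp only [glue, h, dite_false]
    exact (measurable_pi_apply _).comp measurable_fst

lemma Proposals.measurable_metropolisAt_section (Q : Proposals T Γ) (i : Fin d) (γ : Γ i)
    {C : Set ((∀ j : {j : Fin d // j ≠ i}, X j.1) × X i)} (hC : MeasurableSet C) :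
    Measurable fun p : (∀ j : {j : Fin d // j ≠ i}, X j.1) × X i =>
      Q.metropolisAt i p.1 γ p.2 (Prod.mk p.1 ⁻¹' C) := by
  have hD : MeasurableSet {r : ((∀ j : {j : Fin d // j ≠ i}, X j.1) × X i) × X i |
      (r.1.1, r.2) ∈ C} := (measurable_fst.fst.prodMk measurable_snd) hC
  have hκ : Measurable fun p : (∀ j : {j : Fin d // j ≠ i}, X j.1) × X i => (p.1, γ, p.2) :=
    measurable_fst.prodMk (measurable_const.prodMk measurable_snd)
  have h := Kernel.measurable_kernel_prodMk_left (κ := (Q.metropolis i).comap _ hκ) hD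
  exact h

/-- Disintegrating `π` over `x_{-i}` reduces invariance to each fibre, where the Metropolis kernel
preserves the full conditional. Through `glue`, the event to be hit becomes a section that depends
on `x_{-i}` only. -/
lemma Proposals.lintegral_mwg_apply (Q : Proposals T Γ) (i : Fin d) (γ : Γ i)
    {B : Set (∀ j, X j)} (hB : MeasurableSet B) : ∫⁻ x, Q.mwg i γ x B ∂T.π = T.π B := by
  have hlaw : T.π.map (fun x => (dropCoord i x, x i)) = T.π.map (dropCoord i) ⊗ₘ T.cond i :=
    (T.hasCondDistrib i).map_eq
  have hpair : Measurable fun x : ∀ j, X j => (dropCoord i x, x i) :=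
    (measurable_dropCoord i).prodMk (measurable_pi_apply i)
  have hgB := measurable_glue i hB
  have hsec : ∀ u, MeasurableSet (Prod.mk u ⁻¹' (glue i ⁻¹' B)) := fun u =>
    measurable_prodMk_left hgB
  have hF := Q.measurable_metropolisAt_section i γ hgB
  calc ∫⁻ x, Q.mwg i γ x B ∂T.π
      = ∫⁻ x, Q.metropolisAt i (dropCoord i x) γ (x i)
          (Prod.mk (dropCoord i x) ⁻¹' (glue i ⁻¹' B)) ∂T.π := by
        refine lintegral_congr fun x => ?_
        rw [Q.mwg_apply, Measure.map_apply (measurable_update x) hB]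
        simp only [Set.preimage, glue_dropCoord, Set.mem_ofPred_eq]
    _ = ∫⁻ u, ∫⁻ y, Q.metropolisAt i u γ y (Prod.mk u ⁻¹' (glue i ⁻¹' B)) ∂T.cond i u
          ∂(T.π.map (dropCoord i)) := by
        rw [← Measure.lintegral_compProd hF, ← hlaw, lintegral_map hF hpair]
    _ = ∫⁻ u, T.cond i u (Prod.mk u ⁻¹' (glue i ⁻¹' B)) ∂(T.π.map (dropCoord i)) :=
        lintegral_congr fun u =>
          (Q.symmetricKernel_metropolisAt i u γ).lintegral_apply (hsec u)
    _ = T.π B := by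
        rw [← Measure.compProd_apply hgB, ← hlaw, Measure.map_apply hpair hgB]
        congr 1
        ext x
        simp [glue_dropCoord]

lemma Proposals.lintegral_rsmwgAt_pow_apply (Q : Proposals T Γ) {ε : ℝ}
    (θ : selectionSet d ε × (∀ i, Γ i)) (n : ℕ) {B : Set (∀ j, X j)} (hB : MeasurableSet B) :
    ∫⁻ x, (Q.rsmwgAt θ ^ n) x B ∂T.π = T.π B := by
  have hinv : T.π.bind (Q.rsmwgAt θ) = T.π := by
    ext A hA
    rw [Measure.bind_apply hA (Q.rsmwgAt θ).aemeasurable]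
    simp only [Q.rsmwgAt_apply, Measure.coe_finsetSum, Finset.sum_apply, Measure.smul_apply,
      smul_eq_mul]
    rw [lintegral_finsetSum _ fun i _ => ((Q.mwg i (θ.2 i)).measurable_coe hA).const_mul _]
    simp only [lintegral_const_mul _ (Kernel.measurable_coe _ hA), Q.lintegral_mwg_apply _ _ hA]
    rw [← Finset.sum_mul, sum_ofReal_selection, one_mul]
  induction n with
  | zero =>
    have h1 : ∀ x, (Q.rsmwgAt θ ^ 0) x B = B.indicator 1 x := fun x => by
      rw [pow_zero]
      exact Measure.dirac_apply' _ hB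
    rw [lintegral_congr h1, lintegral_indicator_one hB]
  | succ n ih =>
    simp only [pow_succ_apply' _ _ _ hB]
    rw [← Measure.lintegral_bind (Q.rsmwgAt θ).aemeasurable
      (Kernel.measurable_coe _ hB).aemeasurable, hinv, ih]

/-- A minorisation of `rsmwgAt` by the random scan Gibbs sampler. -/
lemma Proposals.exists_smul_rsg_le (Q : Proposals T Γ) {ε : ℝ} (hε : 0 < ε)
    (hc : Q.UniformMinorisation) (β : selectionSet d ε) : ∃ (N : ℕ) (c : ℝ≥0∞), c ≠ 0 ∧
      ∀ (θ : selectionSet d ε × (∀ i, Γ i)) x, c • T.rsg β x ≤ (Q.rsmwgAt θ ^ N) x := by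
  obtain ⟨N, c, hc0, hmin⟩ := hc.exists_smul_cond_le
  have hε' := ENNReal.ofReal_pos.2 hε
  refine ⟨N, ENNReal.ofReal ε ^ N * c, mul_ne_zero (pow_ne_zero N hε'.ne') hc0, fun θ x => ?_⟩
  -- Coordinate `i` is selected `N` times in a row with probability at least `ε ^ N`, and these `N`
  -- Metropolis updates dominate `c` times one Gibbs update.
  have hi : ∀ i, (ENNReal.ofReal ε ^ N * c) • T.gibbs i x ≤ (Q.rsmwgAt θ ^ N) x := fun i => by
    have h1 : ∀ z, ENNReal.ofReal ε • Q.mwg i (θ.2 i) z ≤ Q.rsmwgAt θ z := fun z => by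
      refine Measure.le_iff.2 fun B _ => ?_
      simp only [Q.rsmwgAt_apply, Measure.coe_finsetSum, Finset.sum_apply, Measure.smul_apply,
        smul_eq_mul]
      refine le_trans ?_ (Finset.single_le_sum
        (f := fun i => ENNReal.ofReal (θ.1.1 i) * (Q.mwg i (θ.2 i)) z B)
        (fun _ _ => zero_le) (Finset.mem_univ i))
      gcongr
      exact (θ.1.2.1 i).1
    refine le_trans ?_ (smul_pow_le_pow h1 N x)
    rw [Q.mwg_pow_apply, T.gibbs_apply]
    refine Measure.le_iff.2 fun B hB => ?_
    have hx := measurable_update (a := i) x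
    have h2 := Measure.le_iff.1 (hmin i (dropCoord i x) (θ.2 i) (x i)) _ (hx hB)
    simp only [Measure.smul_apply, smul_eq_mul, Measure.map_apply hx hB, mul_assoc] at h2 ⊢
    gcongr
  refine Measure.le_iff.2 fun B hB => ?_
  have h3 : ∀ i, ENNReal.ofReal ε ^ N * c * T.gibbs i x B ≤ (Q.rsmwgAt θ ^ N) x B := fun i => by
    simpa using Measure.le_iff.1 (hi i) B hB
  simp only [Target.rsg, scanKernel_apply, Measure.smul_apply, Measure.coe_finsetSum,
    Finset.sum_apply, smul_eq_mul, Finset.mul_sum]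
  -- The bound holds for every `i`, hence for the average with weights `β i`, which sum to 1.
  calc ∑ i, ENNReal.ofReal ε ^ N * c * (ENNReal.ofReal (β.1 i) * T.gibbs i x B)
      = ∑ i, ENNReal.ofReal (β.1 i) * (ENNReal.ofReal ε ^ N * c * T.gibbs i x B) :=
        Finset.sum_congr rfl fun i _ => by ring
    _ ≤ ∑ i, ENNReal.ofReal (β.1 i) * (Q.rsmwgAt θ ^ N) x B := by
        gcongr with i
        exact h3 i
    _ = (Q.rsmwgAt θ ^ N) x B := by rw [← Finset.sum_mul, sum_ofReal_selection, one_mul]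

/-- Minorising `K x` on the complement of `B` gives `K x B ≤ 1 - a + a R x B`. Replacing `R x B` by
`R y B + 1/2` and using `a R y B ≤ K y B` leaves the error `1 - a / 2`. -/
lemma apply_le_apply_add_of_minorisation {S : Type*} [MeasurableSpace S] {K R : Kernel S S}
    [IsMarkovKernel K] [IsMarkovKernel R] {a : ℝ≥0∞} (h : ∀ x, a • R x ≤ K x)
    (hR : ∀ x y B, MeasurableSet B → (R x).real B ≤ (R y).real B + 1 / 2) (x y : S) {B : Set S}
    (hB : MeasurableSet B) : K x B ≤ K y B + ENNReal.ofReal (1 - a.toReal / 2) := by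
  have ha1 : a ≤ 1 := by simpa using Measure.le_iff.1 (h x) _ MeasurableSet.univ
  have hreal : ∀ z A, MeasurableSet A → a.toReal * (R z).real A ≤ (K z).real A := fun z A hA => by
    have := ENNReal.toReal_mono (by finiteness) (Measure.le_iff.1 (h z) A hA)
    simpa [Measure.real] using this
  have ha : a.toReal ≤ 1 := by simpa using ENNReal.toReal_mono ENNReal.one_ne_top ha1
  have h1 := hreal x _ hB.compl
  have h2 := hreal y _ hB
  have h3 := mul_le_mul_of_nonneg_left (hR x y B hB) (ENNReal.toReal_nonneg (a := a))
  rw [probReal_compl_eq_one_sub hB, probReal_compl_eq_one_sub hB] at h1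
  rw [← ofReal_measureReal (μ := K x), ← ofReal_measureReal (μ := K y),
    ← ENNReal.ofReal_add measureReal_nonneg (by linarith)]
  exact ENNReal.ofReal_le_ofReal (by linarith)

instance (T : Target X) (i : Fin d) : IsMarkovKernel (T.gibbs i) := by
  unfold Target.gibbs
  infer_instance

instance (T : Target X) {ε : ℝ} (β : selectionSet d ε) : IsMarkovKernel (T.rsg β) := by
  unfold Target.rsg
  infer_instance

/-- The kernels `rsmwgAt θ` are uniformly ergodic, simultaneously in `θ`. -/
lemma Proposals.exists_forall_rsmwgAt_pow_le (Q : Proposals T Γ) {ε : ℝ} (hε : 0 < ε)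
    (hb : ∃ β : selectionSet d ε, UniformlyErgodic (T.rsg β) T.π) (hc : Q.UniformMinorisation)
    {η : ℝ≥0∞} (hη : 0 < η) : ∃ n, ∀ (θ : selectionSet d ε × (∀ i, Γ i)) x B, MeasurableSet B →
      (Q.rsmwgAt θ ^ n) x B ≤ T.π B + η := by
  obtain ⟨β, M, ρ, hρ0, hρ1, hM⟩ := hb
  obtain ⟨N, c, hc0, hmin⟩ := Q.exists_smul_rsg_le hε hc β
  -- Distance 1/4 to `π` from every state makes any two rows differ by at most 1/2.
  obtain ⟨k, hk⟩ : ∃ k, M * ρ ^ k ≤ 1 / 4 := by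
    have : Tendsto (fun k => M * ρ ^ k) atTop (𝓝 (M * 0)) :=
      (tendsto_pow_atTop_nhds_zero_of_lt_one hρ0 hρ1).const_mul M
    rw [mul_zero] at this
    exact (this.eventually_le_const (by norm_num)).exists
  have hR := isMarkovKernel_pow (T.rsg β) k
  have hosc : ∀ x y B, MeasurableSet B →
      ((T.rsg β ^ k) x).real B ≤ ((T.rsg β ^ k) y).real B + 1 / 2 := fun x y B hB => by
    have h1 := (abs_le.1 ((abs_sub_le_tvDist _ T.π hB).trans ((hM k x).trans hk))).2
    have h2 := (abs_le.1 ((abs_sub_le_tvDist _ T.π hB).trans ((hM k y).trans hk))).1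
    linarith
  obtain ⟨x₀⟩ := T.π.nonempty_of_neZero
  by_cases hΘ : Nonempty (selectionSet d ε × (∀ i, Γ i))
  swap
  · exact ⟨0, fun θ => (hΘ ⟨θ⟩).elim⟩
  obtain ⟨θ₀⟩ := hΘ
  -- Comparing total masses at one parameter and one state gives `c ≤ 1`.
  have hcfin : c ≠ ∞ := by
    have := isMarkovKernel_pow (Q.rsmwgAt θ₀) N
    have h1 : c ≤ 1 := by simpa using Measure.le_iff.1 (hmin θ₀ x₀) _ MeasurableSet.univ
    exact ne_top_of_le_ne_top ENNReal.one_ne_top h1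
  have hcpos : 0 < (c ^ k).toReal := ENNReal.toReal_pos (pow_ne_zero k hc0) (by finiteness)
  have hlt : ENNReal.ofReal (1 - (c ^ k).toReal / 2) < 1 := by
    rw [ENNReal.ofReal_lt_one]
    linarith
  obtain ⟨j, hj⟩ : ∃ j, ENNReal.ofReal (1 - (c ^ k).toReal / 2) ^ j ≤ η :=
    ((ENNReal.tendsto_pow_atTop_nhds_zero_of_lt_one hlt).eventually_le_const hη).exists
  -- `N` steps dominate one Gibbs step, `k` such blocks give one contraction, and `j` contractions
  -- bring the error below `η`; none of the three depends on `θ`.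
  refine ⟨N * k * j, fun θ x B hB => ?_⟩
  have hP := isMarkovKernel_pow (Q.rsmwgAt θ) N
  have hP' := isMarkovKernel_pow (Q.rsmwgAt θ ^ N) k
  have hdob : ∀ x y B, MeasurableSet B → ((Q.rsmwgAt θ ^ N) ^ k) x B
      ≤ ((Q.rsmwgAt θ ^ N) ^ k) y B + ENNReal.ofReal (1 - (c ^ k).toReal / 2) :=
    fun x y B hB => apply_le_apply_add_of_minorisation (smul_pow_le_pow (hmin θ) k) hosc x y hB
  have hle : ∀ y, (Q.rsmwgAt θ ^ (N * k * j)) x B ≤ (Q.rsmwgAt θ ^ (N * k * j)) y B + η :=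
    fun y => by
      rw [pow_mul, pow_mul]
      exact (pow_apply_le_pow_apply_add ENNReal.ofReal_ne_top hdob j x y hB).trans (by gcongr)
  -- Averaging the second starting point over the invariant law `π` turns the comparison of two
  -- starts into a comparison with `π`.
  calc (Q.rsmwgAt θ ^ (N * k * j)) x B
      = ∫⁻ _, (Q.rsmwgAt θ ^ (N * k * j)) x B ∂T.π := by simp
    _ ≤ ∫⁻ y, ((Q.rsmwgAt θ ^ (N * k * j)) y B + η) ∂T.π := lintegral_mono hle
    _ = T.π B + η := by
        rw [lintegral_add_right _ measurable_const, Q.lintegral_rsmwgAt_pow_apply θ _ hB]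
        simp

end FixedParameters

section Adaptive

variable {d : ℕ} {X : Fin d → Type*} [∀ i, MeasurableSpace (X i)] {T : Target X}
  {Γ : Fin d → Type*} [∀ i, MeasurableSpace (Γ i)] {ε : ℝ}

/-! ### Dependence of the kernels on the parameters -/

lemma Proposals.tvDist_le_metropolisDist (Q : Proposals T Γ) (i : Fin d) (γ' γ : Γ i)
    (x : ∀ j, X j) :
    tvDist (Q.metropolisAt i (dropCoord i x) γ' (x i)) (Q.metropolisAt i (dropCoord i x) γ (x i))
      ≤ Q.metropolisDist i γ' γ :=
  le_ciSup (f := fun x : ∀ j, X j => tvDist (Q.metropolisAt i (dropCoord i x) γ' (x i))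
    (Q.metropolisAt i (dropCoord i x) γ (x i)))
    ⟨1, by
      rintro _ ⟨x, rfl⟩
      exact Real.iSup_le (fun A => abs_measureReal_sub_le_one _ _ _) zero_le_one⟩ x

lemma abs_sub_le_selectionDist (α α' : selectionSet d ε) (i : Fin d) :
    |α.1 i - α'.1 i| ≤ selectionDist α α' := by
  have := PiLp.norm_apply_le (WithLp.toLp 2 (α.1 - α'.1)) i
  simpa [selectionDist] using this

lemma Proposals.real_rsmwgAt_apply (Q : Proposals T Γ) (θ : selectionSet d ε × (∀ i, Γ i))
    (x : ∀ j, X j) (B : Set (∀ j, X j)) :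
    (Q.rsmwgAt θ x).real B = ∑ i, θ.1.1 i * (Q.mwg i (θ.2 i) x).real B := by
  rw [Measure.real, Q.rsmwgAt_apply]
  simp only [Measure.coe_finsetSum, Finset.sum_apply, Measure.smul_apply, smul_eq_mul]
  rw [ENNReal.toReal_sum fun i _ => by finiteness]
  refine Finset.sum_congr rfl fun i _ => ?_
  rw [ENNReal.toReal_mul, ENNReal.toReal_ofReal (θ.1.2.2.1 i), Measure.real]

/-- Each summand is split as `α' m' - α m = (α' - α) m' + α (m' - m)`; both terms are at most `δ`,
and there are `d` coordinates. -/
lemma Proposals.rsmwgAt_apply_le (Q : Proposals T Γ) {θ' θ : selectionSet d ε × (∀ i, Γ i)} {δ : ℝ}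
    (hδ : 0 ≤ δ) (hα : selectionDist θ'.1 θ.1 ≤ δ)
    (hγ : ∀ i, Q.metropolisDist i (θ'.2 i) (θ.2 i) ≤ δ) (x : ∀ j, X j) {B : Set (∀ j, X j)}
    (hB : MeasurableSet B) :
    Q.rsmwgAt θ' x B ≤ Q.rsmwgAt θ x B + ENNReal.ofReal (d * (2 * δ)) := by
  rw [← ofReal_measureReal (μ := Q.rsmwgAt θ' x), ← ofReal_measureReal (μ := Q.rsmwgAt θ x),
    ← ENNReal.ofReal_add measureReal_nonneg (by positivity)]
  refine ENNReal.ofReal_le_ofReal ?_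
  rw [Q.real_rsmwgAt_apply, Q.real_rsmwgAt_apply]
  calc ∑ i, θ'.1.1 i * (Q.mwg i (θ'.2 i) x).real B
      ≤ ∑ i, (θ.1.1 i * (Q.mwg i (θ.2 i) x).real B + 2 * δ) := by
        refine Finset.sum_le_sum fun i _ => ?_
        have h1 := (abs_le.1 ((abs_sub_le_selectionDist θ'.1 θ.1 i).trans hα)).2
        have hx := measurable_update (a := i) x
        have h2 := (abs_le.1 ((abs_sub_le_tvDist _ _ (hx hB)).trans
          ((Q.tvDist_le_metropolisDist i (θ'.2 i) (θ.2 i) x).trans (hγ i)))).2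
        rw [Q.mwg_apply, Q.mwg_apply, map_measureReal_apply hx hB, map_measureReal_apply hx hB]
        generalize (Q.metropolisAt i (dropCoord i x) (θ.2 i) (x i)).real _ = m at h2 ⊢
        have h3 : (Q.metropolisAt i (dropCoord i x) (θ'.2 i) (x i)).real
          (Function.update x i ⁻¹' B) ≤ 1 := measureReal_le_one
        have h4 : 0 ≤ (Q.metropolisAt i (dropCoord i x) (θ'.2 i) (x i)).real
          (Function.update x i ⁻¹' B) := measureReal_nonneg
        generalize (Q.metropolisAt i (dropCoord i x) (θ'.2 i) (x i)).real _ = m' at h2 h3 h4 ⊢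
        have h5 := θ.1.2.2.1 i
        have h6 := (θ.1.2.1 i).2
        have h7 : (θ'.1.1 i - θ.1.1 i) * m' ≤ δ :=
          (mul_le_mul_of_nonneg_right h1 h4).trans (mul_le_of_le_one_right hδ h3)
        have h8 : θ.1.1 i * (m' - m) ≤ δ :=
          (mul_le_mul_of_nonneg_left h2 h5).trans (mul_le_of_le_one_left hδ h6)
        linarith
    _ = ∑ i, θ.1.1 i * (Q.mwg i (θ.2 i) x).real B + d * (2 * δ) := by
        rw [Finset.sum_add_distrib, Finset.sum_const, Finset.card_univ, Fintype.card_fin,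
          nsmul_eq_mul]

/-- Joint measurability in the parameter is needed because the parameter frozen at time `K` is
itself random. -/
lemma Proposals.measurable_rsmwgAt_pow_apply (Q : Proposals T Γ) (n : ℕ) {B : Set (∀ j, X j)}
    (hB : MeasurableSet B) :
    Measurable fun p : (selectionSet d ε × (∀ i, Γ i)) × (∀ j, X j) =>
      (Q.rsmwgAt p.1 ^ n) p.2 B := by
  induction n with
  | zero =>
    have h1 : ∀ p : (selectionSet d ε × (∀ i, Γ i)) × (∀ j, X j),
        (Q.rsmwgAt p.1 ^ 0) p.2 B = B.indicator 1 p.2 := fun p => by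
      rw [pow_zero]
      exact Measure.dirac_apply' _ hB
    simp_rw [h1]
    exact (measurable_one.indicator hB).comp measurable_snd
  | succ n ih =>
    simp_rw [pow_succ_apply' _ _ _ hB]
    let κ : Kernel ((selectionSet d ε × (∀ i, Γ i)) × (∀ j, X j)) (∀ j, X j) :=
      (rsmwg Q ε).comap Prod.swap measurable_swap
    have h := Measurable.lintegral_kernel_prod_right (κ := κ)
      (f := fun p z => (Q.rsmwgAt p.1 ^ n) z B)
      (ih.comp (measurable_fst.fst.prodMk measurable_snd))
    exact h

/-! ### Markov property of the trajectory -/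

variable (Q : Proposals T Γ) (R : AdaptRule X Γ ε) [∀ n, IsMarkovKernel (R n)]

instance (s : AdaptState X Γ ε) : IsProbabilityMeasure (trajLaw Q R s) := by
  unfold trajLaw
  infer_instance

lemma lintegral_trajLaw_succ (s : AdaptState X Γ ε) (k : ℕ)
    {φ : (∀ _ : Finset.Iic k, AdaptState X Γ ε) × AdaptState X Γ ε → ℝ≥0∞} (hφ : Measurable φ) :
    ∫⁻ ω, φ (Preorder.frestrictLe k ω, ω (k + 1)) ∂trajLaw Q R s
      = ∫⁻ ω, ∫⁻ z, φ (Preorder.frestrictLe k ω, z) ∂stepKernel Q R k (Preorder.frestrictLe k ω)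
          ∂trajLaw Q R s := by
  have hm : Measurable fun ω : ℕ → AdaptState X Γ ε =>
      (Preorder.frestrictLe (π := fun _ => AdaptState X Γ ε) k ω, ω (k + 1)) := by fun_prop
  have hr : Measurable (Preorder.frestrictLe (π := fun _ => AdaptState X Γ ε) k) := by fun_prop
  rw [← lintegral_map hφ hm, trajLaw,
    ← Kernel.partialTraj_compProd_eq_map_traj (X := fun _ => AdaptState X Γ ε) (Nat.zero_le k),
    Measure.lintegral_compProd hφ,
    ← Kernel.traj_map_frestrictLe_apply (X := fun _ => AdaptState X Γ ε),
    lintegral_map hφ.lintegral_kernel_prod_right' hr]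

lemma lintegral_stepKernel (k : ℕ) (h : ∀ _ : Finset.Iic k, AdaptState X Γ ε)
    {φ : AdaptState X Γ ε → ℝ≥0∞} (hφ : Measurable φ) :
    ∫⁻ z, φ z ∂stepKernel Q R k h
      = ∫⁻ θ, ∫⁻ x, φ (x, θ) ∂Q.rsmwgAt θ (h ⟨k, Finset.mem_Iic.2 le_rfl⟩).1 ∂(R k h) := by
  rw [stepKernel, Kernel.lintegral_map _ measurable_swap _ hφ]
  exact Kernel.lintegral_compProd _ _ _ (hφ.comp measurable_swap)

/-- Given the history and the current parameters, `X_{k+1}` has law `P_{θ_{k+1}}(X_k, ·)`. -/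
lemma lintegral_state_succ (s : AdaptState X Γ ε) {K k : ℕ} (hK : K ≤ k)
    {g : (selectionSet d ε × (∀ i, Γ i)) × (∀ j, X j) → ℝ≥0∞} (hg : Measurable g) :
    ∫⁻ ω, g ((ω K).2, (ω (k + 1)).1) ∂trajLaw Q R s
      = ∫⁻ ω, ∫⁻ x, g ((ω K).2, x) ∂Q.rsmwgAt (ω (k + 1)).2 (ω k).1 ∂trajLaw Q R s := by
  let a : Finset.Iic k := ⟨K, Finset.mem_Iic.2 hK⟩
  let b : Finset.Iic k := ⟨k, Finset.mem_Iic.2 le_rfl⟩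
  have hφ : Measurable fun p : (∀ _ : Finset.Iic k, AdaptState X Γ ε) × AdaptState X Γ ε =>
      g ((p.1 a).2, p.2.1) := hg.comp (by fun_prop)
  have hsrc : Measurable fun p : (∀ _ : Finset.Iic k, AdaptState X Γ ε) × AdaptState X Γ ε =>
      ((p.1 b).1, p.2.2) := by fun_prop
  have hψ : Measurable fun p : (∀ _ : Finset.Iic k, AdaptState X Γ ε) × AdaptState X Γ ε =>
      ∫⁻ x, g ((p.1 a).2, x) ∂(rsmwg Q ε).comap _ hsrc p :=
    Measurable.lintegral_kernel_prod_right
      (f := fun (p : (∀ _ : Finset.Iic k, AdaptState X Γ ε) × AdaptState X Γ ε) x =>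
        g ((p.1 a).2, x))
      (hg.comp (by fun_prop))
  -- The function in `hψ` averages out the new state and depends on the new parameters and the
  -- history only, so both functions have the same integral over one step.
  refine (lintegral_trajLaw_succ Q R s k hφ).trans (Eq.trans ?_
    (lintegral_trajLaw_succ Q R s k hψ).symm)
  refine lintegral_congr fun ω => ?_
  have e1 := lintegral_stepKernel Q R k (Preorder.frestrictLe k ω)
    (hφ.comp (measurable_prodMk_left (x := Preorder.frestrictLe k ω)))
  have e2 := lintegral_stepKernel Q R k (Preorder.frestrictLe k ω)
    (hψ.comp (measurable_prodMk_left (x := Preorder.frestrictLe k ω)))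
  refine e1.trans (Eq.trans ?_ e2.symm)
  refine lintegral_congr fun θ => ?_
  simp only [Function.comp_apply, Kernel.comap_apply, lintegral_const, measure_univ, mul_one]
  rfl

/-! ### Comparison with the non-adaptive chain -/

/-- The adaptation at time `k` exceeds `δ`. -/
def largeIncrement (δ : ℝ) (k : ℕ) : Set (ℕ → AdaptState X Γ ε) :=
  {ω | δ ≤ |selectionIncrement k ω|} ∪ ⋃ i, {ω | δ ≤ |metropolisIncrement Q i k ω|}

/-- The error telescopes over `j` consecutive changes of parameter. -/
lemma rsmwgAt_apply_le_of_small_increments {δ : ℝ} (hδ : 0 ≤ δ) (K j : ℕ)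
    {ω : ℕ → AdaptState X Γ ε} (hω : ∀ l < j, ω ∉ largeIncrement Q δ (K + l)) (x : ∀ j, X j)
    {B : Set (∀ j, X j)} (hB : MeasurableSet B) :
    Q.rsmwgAt (ω (K + j)).2 x B
      ≤ Q.rsmwgAt (ω K).2 x B + j * ENNReal.ofReal (d * (2 * δ)) := by
  induction j with
  | zero => simp
  | succ j ih =>
    have h := hω j j.lt_succ_self
    simp only [largeIncrement, Set.mem_union, Set.mem_ofPred_eq, Set.mem_iUnion, not_or, not_le,
      not_exists] at h
    have h1 := Q.rsmwgAt_apply_le (θ' := (ω (K + j + 1)).2) (θ := (ω (K + j)).2) hδ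
      ((le_abs_self _).trans h.1.le) (fun i => (le_abs_self _).trans (h.2 i).le) x hB
    refine h1.trans ((add_le_add_left (ih fun l hl => hω l (hl.trans j.lt_succ_self)) _).trans ?_)
    rw [add_assoc, Nat.cast_add, Nat.cast_one, add_mul, one_mul]

/-- `E` may be non-measurable, since the Metropolis increments are suprema over the state space. Its
measurable hull has the same outer measure. -/
lemma lintegral_le_lintegral_add_measure {Ω : Type*} [MeasurableSpace Ω] {μ : Measure Ω}
    [IsProbabilityMeasure μ] {a b : Ω → ℝ≥0∞} {c : ℝ≥0∞} {E : Set Ω} (ha : ∀ ω, a ω ≤ 1)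
    (hab : ∀ ω, ω ∉ E → a ω ≤ b ω + c) : ∫⁻ ω, a ω ∂μ ≤ ∫⁻ ω, b ω ∂μ + (c + μ E) := by
  have hE := measurableSet_toMeasurable μ E
  have hind : Measurable fun ω => c + (toMeasurable μ E).indicator 1 ω :=
    measurable_const.add (measurable_one.indicator hE)
  calc ∫⁻ ω, a ω ∂μ ≤ ∫⁻ ω, (b ω + (c + (toMeasurable μ E).indicator 1 ω)) ∂μ := by
        refine lintegral_mono fun ω => ?_
        by_cases h : ω ∈ toMeasurable μ E
        · rw [Set.indicator_of_mem h]
          exact (ha ω).trans (le_add_self.trans le_add_self)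
        · refine (hab ω fun h' => h (subset_toMeasurable μ E h')).trans ?_
          gcongr
          exact le_self_add
    _ = ∫⁻ ω, b ω ∂μ + (c + μ E) := by
        rw [lintegral_add_right _ hind,
          lintegral_add_right _ (measurable_one.indicator hE), lintegral_indicator_one hE,
          measure_toMeasurable]
        simp

/-- Hybrid chains: run the adaptive chain for `j` steps after time `K`, then `m` steps with the
parameters of time `K`. Trading the last adaptive step for a frozen one lowers `j`, raises `m`, and
costs the same amount each time. -/
lemma lintegral_rsmwgAt_pow_le (s : AdaptState X Γ ε) {δ : ℝ} (hδ : 0 ≤ δ) (K n m : ℕ)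
    {B : Set (∀ j, X j)} (hB : MeasurableSet B) {j : ℕ} (hj : j ≤ n) :
    ∫⁻ ω, (Q.rsmwgAt (ω K).2 ^ m) (ω (K + j)).1 B ∂trajLaw Q R s
      ≤ ∫⁻ ω, (Q.rsmwgAt (ω K).2 ^ (m + j)) (ω K).1 B ∂trajLaw Q R s
        + j * (n * ENNReal.ofReal (d * (2 * δ))
          + ∑ l ∈ Finset.range n, trajLaw Q R s (largeIncrement Q δ (K + l))) := by
  induction j generalizing m with
  | zero => simp
  | succ j ih =>
    set c := n * ENNReal.ofReal (d * (2 * δ))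
      + ∑ l ∈ Finset.range n, trajLaw Q R s (largeIncrement Q δ (K + l)) with hc
    have hstep : ∫⁻ ω, (Q.rsmwgAt (ω K).2 ^ m) (ω (K + (j + 1))).1 B ∂trajLaw Q R s
        ≤ ∫⁻ ω, (Q.rsmwgAt (ω K).2 ^ (m + 1)) (ω (K + j)).1 B ∂trajLaw Q R s + c := by
      have h1 := lintegral_state_succ Q R s (Nat.le_add_right K j)
        (Q.measurable_rsmwgAt_pow_apply (ε := ε) m hB)
      refine h1.le.trans ((lintegral_le_lintegral_add_measure
        (b := fun ω => (Q.rsmwgAt (ω K).2 ^ (m + 1)) (ω (K + j)).1 B)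
        (c := n * ENNReal.ofReal (d * (2 * δ)))
        (E := ⋃ l ∈ Finset.range n, largeIncrement Q δ (K + l)) (fun ω => ?_)
        fun ω hω => ?_).trans ?_)
      · have := isMarkovKernel_pow (Q.rsmwgAt (ω K).2) m
        calc ∫⁻ x, (Q.rsmwgAt (ω K).2 ^ m) x B ∂Q.rsmwgAt (ω (K + j + 1)).2 (ω (K + j)).1
            ≤ ∫⁻ _, 1 ∂Q.rsmwgAt (ω (K + j + 1)).2 (ω (K + j)).1 :=
              lintegral_mono fun x => prob_le_one
          _ = 1 := by simp
      · have := isMarkovKernel_pow (Q.rsmwgAt (ω K).2) m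
        simp only [Set.mem_iUnion, Finset.mem_range, not_exists] at hω
        dsimp only
        rw [pow_succ_apply' _ _ _ hB]
        -- Off the exceptional event, the parameters at time `K + j + 1` are at most `n` small
        -- increments away from those at time `K`.
        have h2 := lintegral_le_lintegral_add_mul (r := 1)
          (μ := Q.rsmwgAt (ω (K + j + 1)).2 (ω (K + j)).1)
          (ν := Q.rsmwgAt (ω K).2 (ω (K + j)).1)
          (fun A hA => rsmwgAt_apply_le_of_small_increments Q hδ K (j + 1)
            (fun l hl => hω l (hl.trans_le hj)) _ hA)
          ((Q.rsmwgAt (ω K).2 ^ m).measurable_coe hB) ENNReal.one_ne_top fun x => prob_le_one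
        refine h2.trans ?_
        rw [one_mul]
        gcongr
      · rw [hc]
        gcongr
        exact measure_biUnion_finset_le (μ := trajLaw Q R s) _ _
    refine hstep.trans ((add_le_add_left (ih (m + 1) (j.le_succ.trans hj)) c).trans ?_)
    rw [show m + 1 + j = m + (j + 1) by ring, add_assoc, Nat.cast_add, Nat.cast_one, add_mul,
      one_mul]

/-- Quantitative comparison of the law of `X_{K+n}` with `π`. -/
lemma map_trajLaw_apply_le {n : ℕ} {η : ℝ≥0∞}
    (hn : ∀ (θ : selectionSet d ε × (∀ i, Γ i)) x B, MeasurableSet B →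
      (Q.rsmwgAt θ ^ n) x B ≤ T.π B + η) (s : AdaptState X Γ ε) {δ : ℝ} (hδ : 0 ≤ δ) (K : ℕ)
    {B : Set (∀ j, X j)} (hB : MeasurableSet B) :
    (trajLaw Q R s).map (fun ω => (ω (K + n)).1) B
      ≤ T.π B + (η + n * (n * ENNReal.ofReal (d * (2 * δ))
        + ∑ l ∈ Finset.range n, trajLaw Q R s (largeIncrement Q δ (K + l)))) := by
  have hm : Measurable fun ω : ℕ → AdaptState X Γ ε => (ω (K + n)).1 := by fun_prop
  -- The law of the state is the hybrid with `m = 0`, the zeroth power being a Dirac mass.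
  have h0 : (trajLaw Q R s).map (fun ω => (ω (K + n)).1) B
      = ∫⁻ ω, (Q.rsmwgAt (ω K).2 ^ 0) (ω (K + n)).1 B ∂trajLaw Q R s := by
    rw [Measure.map_apply hm hB, ← lintegral_indicator_one (hm hB)]
    refine lintegral_congr fun ω => ?_
    rw [pow_zero]
    exact (Measure.dirac_apply' _ hB).symm
  rw [h0, ← add_assoc]
  refine (lintegral_rsmwgAt_pow_le Q R s hδ K n 0 hB le_rfl).trans ?_
  gcongr
  rw [zero_add]
  calc ∫⁻ ω, (Q.rsmwgAt (ω K).2 ^ n) (ω K).1 B ∂trajLaw Q R s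
      ≤ ∫⁻ _, (T.π B + η) ∂trajLaw Q R s := lintegral_mono fun ω => hn _ _ B hB
    _ = T.π B + η := by simp

/-! ### Convergence -/

lemma tendsto_iSup_largeIncrement {S : Set (AdaptState X Γ ε)}
    (hA : TendstoZeroInProbUniformly Q R S selectionIncrement)
    (hD : ∀ i, TendstoZeroInProbUniformly Q R S (metropolisIncrement Q i)) {δ : ℝ} (hδ : 0 < δ) :
    Tendsto (fun k => ⨆ s ∈ S, trajLaw Q R s (largeIncrement Q δ k)) atTop (𝓝 0) := by
  have h : Tendsto (fun k => (⨆ s ∈ S, trajLaw Q R s {ω | δ ≤ |selectionIncrement k ω|})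
      + ∑ i, ⨆ s ∈ S, trajLaw Q R s {ω | δ ≤ |metropolisIncrement Q i k ω|}) atTop (𝓝 0) := by
    simpa using (hA δ hδ).add (tendsto_finsetSum Finset.univ fun i _ => hD i δ hδ)
  refine tendsto_of_tendsto_of_tendsto_of_le_of_le tendsto_const_nhds h (fun _ => zero_le)
    fun k => iSup₂_le fun s hs => ?_
  refine (measure_union_le _ _).trans (add_le_add (le_iSup₂_of_le s hs le_rfl) ?_)
  refine (measure_iUnion_fintype_le _ _).trans (Finset.sum_le_sum fun i _ => ?_)
  exact le_iSup₂_of_le (f := fun s (_ : s ∈ S) =>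
    trajLaw Q R s {ω | δ ≤ |metropolisIncrement Q i k ω|}) s hs le_rfl

/-- The doubly adaptive sampler converges to `π` uniformly over a set of starting values on which
the adaptation diminishes uniformly. -/
lemma eventually_distToTarget_le (hε : 0 < ε)
    (hb : ∃ β : selectionSet d ε, UniformlyErgodic (T.rsg β) T.π) (hc : Q.UniformMinorisation)
    {S : Set (AdaptState X Γ ε)} (hA : TendstoZeroInProbUniformly Q R S selectionIncrement)
    (hD : ∀ i, TendstoZeroInProbUniformly Q R S (metropolisIncrement Q i)) {e : ℝ} (he : 0 < e) :
    ∀ᶠ n in atTop, ∀ s ∈ S, distToTarget Q R s n ≤ e := by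
  have he3 : 0 < e / 3 := by positivity
  obtain ⟨n, hn⟩ := Q.exists_forall_rsmwgAt_pow_le hε hb hc (ENNReal.ofReal_pos.2 he3)
  -- The second third of the error is the drift over the window; the `+ 1` in the witness guards
  -- against a zero denominator. The last third bounds the large increments once `K` is large.
  obtain ⟨δ, hδ, hδe⟩ : ∃ δ : ℝ, 0 < δ ∧ n * (n * (d * (2 * δ))) ≤ e / 3 := by
    refine ⟨e / 3 / (2 * n * n * d + 1), by positivity, ?_⟩
    rw [show (n : ℝ) * (n * (d * (2 * (e / 3 / (2 * n * n * d + 1)))))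
      = e / 3 * (2 * n * n * d / (2 * n * n * d + 1)) by ring]
    exact mul_le_of_le_one_right he3.le (div_le_one_of_le₀ (by linarith) (by positivity))
  have hlim : Tendsto (fun K => (n : ℝ≥0∞) * ∑ l ∈ Finset.range n,
      ⨆ s ∈ S, trajLaw Q R s (largeIncrement Q δ (K + l))) atTop (𝓝 0) := by
    have h1 : Tendsto (fun K => ∑ l ∈ Finset.range n,
        ⨆ s ∈ S, trajLaw Q R s (largeIncrement Q δ (K + l))) atTop
          (𝓝 (∑ _ ∈ Finset.range n, 0)) :=
      tendsto_finsetSum _ fun l _ =>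
        (tendsto_iSup_largeIncrement Q R hA hD hδ).comp (tendsto_add_atTop_nat l)
    simpa using ENNReal.Tendsto.const_mul h1 (Or.inr (ENNReal.natCast_ne_top n))
  have hev := hlim.eventually_le_const (ENNReal.ofReal_pos.2 he3)
  filter_upwards [(tendsto_sub_atTop_nat n).eventually hev, eventually_ge_atTop n]
    with N hN hnN s hs
  obtain ⟨K, rfl⟩ := Nat.exists_eq_add_of_le' hnN
  rw [Nat.add_sub_cancel] at hN
  have hm : Measurable fun ω : ℕ → AdaptState X Γ ε => (ω (K + n)).1 := by fun_prop
  have : IsProbabilityMeasure ((trajLaw Q R s).map fun ω => (ω (K + n)).1) :=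
    Measure.isProbabilityMeasure_map hm.aemeasurable
  refine tvDist_le_of_one_sided he.le fun B hB => ?_
  refine (map_trajLaw_apply_le Q R hn s hδ.le K hB).trans ?_
  gcongr
  rw [show e = e / 3 + (e / 3 + e / 3) by ring, ENNReal.ofReal_add he3.le (by positivity),
    ENNReal.ofReal_add he3.le he3.le, mul_add]
  refine add_le_add (by ring_nf; rfl) (add_le_add ?_ ?_)
  · rw [← ENNReal.ofReal_natCast n, ← ENNReal.ofReal_mul (by positivity),
      ← ENNReal.ofReal_mul (by positivity)]
    exact ENNReal.ofReal_le_ofReal hδe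
  · refine le_trans ?_ hN
    gcongr with l
    exact le_iSup₂_of_le (f := fun s (_ : s ∈ S) => trajLaw Q R s (largeIncrement Q δ (K + l)))
      s hs le_rfl

end Adaptive

end AdaptiveGibbs

open AdaptiveGibbs in
theorem mainTheorem4 {d : ℕ} {X : Fin d → Type*} [∀ i, MeasurableSpace (X i)]
    {Γ : Fin d → Type*} [∀ i, MeasurableSpace (Γ i)]
    (T : Target X) (Q : Proposals T Γ)
    (ε : ℝ) (hε : 0 < ε) (hεd : ε ≤ 1 / (d : ℝ))
    (R : AdaptRule X Γ ε) [∀ n, IsMarkovKernel (R n)]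
    (hb : ∃ β : selectionSet d ε, UniformlyErgodic (T.rsg β) T.π)
    (hc : Q.UniformMinorisation) :
    (∀ s : AdaptState X Γ ε,
      TendstoInMeasure (trajLaw Q R s) selectionIncrement atTop (fun _ => 0) →
      (∀ i, TendstoInMeasure (trajLaw Q R s) (metropolisIncrement Q i) atTop (fun _ => 0)) →
      Tendsto (distToTarget Q R s) atTop (𝓝 0)) ∧
    (∀ G : Set (∀ i, Γ i),
      TendstoZeroInProbUniformly Q R {s | s.2.2 ∈ G} selectionIncrement →
      (∀ i, TendstoZeroInProbUniformly Q R {s | s.2.2 ∈ G} (metropolisIncrement Q i)) →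
      Tendsto (fun n => ⨆ s : {s : AdaptState X Γ ε // s.2.2 ∈ G}, distToTarget Q R s.1 n)
        atTop (𝓝 0)) := by
  have hnn : ∀ s n, 0 ≤ distToTarget Q R s n := fun s n => tvDist_nonneg _ _
  have hzero : ∀ u : ℕ → ℝ, (∀ n, 0 ≤ u n) → (∀ e > 0, ∀ᶠ n in atTop, u n ≤ e) →
      Tendsto u atTop (𝓝 0) := fun u hu h => by
    rw [tendsto_order]
    refine ⟨fun a ha => Eventually.of_forall fun n => ha.trans_le (hu n), fun a ha => ?_⟩
    filter_upwards [h (a / 2) (half_pos ha)] with n hn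
    linarith
  refine ⟨fun s hA hD => ?_, fun G hA hD => ?_⟩
  -- Convergence from one starting value is the uniform statement on a singleton.
  · have hconv : ∀ D : ℕ → (ℕ → AdaptState X Γ ε) → ℝ,
        TendstoInMeasure (trajLaw Q R s) D atTop (fun _ => 0) →
        TendstoZeroInProbUniformly Q R {s} D := fun D h δ hδ => by
      simpa using tendstoInMeasure_iff_norm.1 h δ hδ
    refine hzero _ (hnn s) fun e he => ?_
    filter_upwards [eventually_distToTarget_le Q R hε hb hc (hconv _ hA)
      (fun i => hconv _ (hD i)) he] with n hn
    exact hn s rfl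
  · refine hzero _ (fun n => Real.iSup_nonneg fun s => hnn _ _) fun e he => ?_
    filter_upwards [eventually_distToTarget_le Q R hε hb hc hA hD he] with n hn
    exact Real.iSup_le (fun s => hn s.1 s.2) he.le
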